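/- Write an abelian variety over $\mathbb{C}$ of dimension $g$ as $X=\mathbb{C}^g/\Lambda$, where $\Lambda$ is a lattice such that there is a positive definite Hermitian form on $\mathbb{C}^g$ whose imaginary part takes integer values on $\Lambda\times\Lambda$. An endomorphism of $X$ is a holomorphic map $X\to X$ that preserves the group structure, and an automorphism is an endomorphism that has an inverse endomorphism. $X$ is called simple if it contains no abelian subvariety except $0$ and $X$. The first dynamical degree of a surjective endomorphism $f$ of $X$ is $$\lambda_1(f)=\lim_{n\to\infty}\bigl\|(f^n)^*:\mathrm{H}^{1,1}(X)\to \mathrm{H}^{1,1}(X)\bigr\|^{1/n},$$ where $\mathrm{H}^{1,1}(X)$ is the Dolbeault cohomology (the $\bar\partial$-closed smooth $(1,1)$-forms modulo the $\bar\partial$-exact ones) and $\|\cdot\|$ is any norm on the space of its linear endomorphisms. Theorem. Let $g\ge 2$ be an integer. Each of the two sets $$\mathcal{A}_g=\{\lambda_1(f) : f \text{ a surjective endomorphism of an abelian variety over } \mathbb{C} \text{ of dimension } g\}\setminus\{1\},$$ $$\mathcal{B}_g=\{\lambda_1(f) : f \text{ an automorphism of a simple abelian variety over } \mathbb{C} \text{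 of dimension } g\}\setminus\{1\}$$ has a minimum; in particular, both sets are non-empty. -/

import Mathlib

open scoped Topology ContDiff

/-- A complex torus `ℂ^g / Λ` of dimension `g`, given by its lattice `Λ`. -/
structure ComplexTorus (g : ℕ) where
  /-- the lattice `Λ ⊆ ℂ^g` -/
  lattice : Submodule ℤ (Fin g → ℂ)
  /-- `Λ` is discrete -/
  discrete : DiscreteTopology lattice
  /-- `Λ` spans `ℂ^g` over `ℝ` -/
  span_top : Submodule.span ℝ (lattice : Set (Fin g → ℂ)) = ⊤

namespace ComplexTorus

variable {g m k : ℕ}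

/-- The points of the torus, i.e. the group `ℂ^g / Λ`. -/
abbrev Pts (X : ComplexTorus g) : Type := (Fin g → ℂ) ⧸ X.lattice

/-- The projection `ℂ^g → ℂ^g / Λ`. -/
def proj (X : ComplexTorus g) : (Fin g → ℂ) →ₗ[ℤ] X.Pts := X.lattice.mkQ

theorem proj_eq_iff (X : ComplexTorus g) (v w : Fin g → ℂ) :
    X.proj v = X.proj w ↔ v - w ∈ X.lattice :=
  Submodule.Quotient.eq X.lattice

theorem proj_surjective (X : ComplexTorus g) : Function.Surjective X.proj :=
  Submodule.mkQ_surjective X.lattice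

/-- A complex torus is an abelian variety if it admits a polarization (Riemann form): a positive
definite Hermitian form `H` on `ℂ^g` whose imaginary part is integer-valued on `Λ × Λ`. -/
def IsAbelianVariety (X : ComplexTorus g) : Prop :=
  ∃ H : Matrix (Fin g) (Fin g) ℂ, H.IsHermitian ∧
    (∀ x : Fin g → ℂ, x ≠ 0 → 0 < (star x ⬝ᵥ H.mulVec x).re) ∧
    ∀ x ∈ X.lattice, ∀ y ∈ X.lattice, ∃ n : ℤ, (star x ⬝ᵥ H.mulVec y).im = n

/-- A map between complex tori is holomorphic if around every point of the universal covering
`ℂ^g` it is induced by a holomorphic map `ℂ^g → ℂ^m` defined near that point (the local inverses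
of the projections are the holomorphic charts of the tori). -/
def IsHolomorphic (X : ComplexTorus g) (Y : ComplexTorus m) (f : X.Pts → Y.Pts) : Prop :=
  ∀ v : Fin g → ℂ, ∃ F : (Fin g → ℂ) → (Fin m → ℂ), AnalyticAt ℂ F v ∧
    ∀ᶠ w in 𝓝 v, f (X.proj w) = Y.proj (F w)

/-- A complex torus is simple if it contains no abelian subvariety except `0` and itself; an
abelian subvariety is the image of an injective holomorphic homomorphism from an abelian
variety. -/
def IsSimple (X : ComplexTorus g) : Prop :=
  ∀ (m : ℕ) (Y : ComplexTorus m), Y.IsAbelianVariety →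
    ∀ i : Y.Pts →+ X.Pts, IsHolomorphic Y X i → Function.Injective i →
      i.range = ⊥ ∨ i.range = ⊤

theorem isHolomorphic_id (X : ComplexTorus g) : IsHolomorphic X X id :=
  fun _ => ⟨id, analyticAt_id, Filter.Eventually.of_forall fun _ => rfl⟩

theorem IsHolomorphic.comp {X : ComplexTorus g} {Y : ComplexTorus m} {Z : ComplexTorus k}
    {f : Y.Pts → Z.Pts} {f' : X.Pts → Y.Pts} (hf : IsHolomorphic Y Z f)
    (hf' : IsHolomorphic X Y f') : IsHolomorphic X Z (f ∘ f') := by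
  intro v
  obtain ⟨F', hF', h'⟩ := hf' v
  obtain ⟨F, hF, h⟩ := hf (F' v)
  refine ⟨F ∘ F', hF.comp hF', ?_⟩
  filter_upwards [h', hF'.continuousAt.eventually h] with w h1 h2
  simp only [Function.comp_apply, h1, h2]

/-- The monoid (under composition) of endomorphisms of a complex torus: holomorphic maps which
preserve the group structure. -/
def endo (X : ComplexTorus g) : Submonoid (AddMonoid.End X.Pts) where
  carrier := {f | IsHolomorphic X X f}
  one_mem' := isHolomorphic_id X
  mul_mem' := fun ha hb => IsHolomorphic.comp ha hb

/-- A holomorphic homomorphism of complex tori lifts to a `ℂ`-linear map. -/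
theorem exists_linear_lift {X : ComplexTorus g} {Y : ComplexTorus m} (f : X.Pts →+ Y.Pts)
    (hf : IsHolomorphic X Y f) :
    ∃ B : (Fin g → ℂ) →L[ℂ] (Fin m → ℂ), ∀ v, f (X.proj v) = Y.proj (B v) := by
  obtain ⟨F, hF, hlift⟩ := hf 0
  have hF0 : Y.proj (F 0) = 0 := by
    rw [← hlift.self_of_nhds, map_zero, map_zero]
  obtain ⟨e, he, hball⟩ : ∃ e > 0, ∀ x ∈ Y.lattice, ‖x‖ < e → x = 0 := by
    have := Y.discrete
    obtain ⟨e, he, hs⟩ := Metric.exists_ball_inter_eq_singleton_of_mem_discrete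
      (s := (Y.lattice : Set (Fin m → ℂ))) (isDiscrete_iff_discreteTopology.2 this) Y.lattice.zero_mem
    refine ⟨e, he, fun x hx hxe => ?_⟩
    have : x ∈ Metric.ball (0 : Fin m → ℂ) e ∩ (Y.lattice : Set (Fin m → ℂ)) :=
      ⟨by simpa using hxe, hx⟩
    rw [hs] at this
    exact this
  have hcont : ∀ᶠ w in 𝓝 (0 : Fin g → ℂ), ‖F w - F 0‖ < e / 3 := by
    have := Metric.continuousAt_iff'.1 hF.continuousAt (e / 3) (by positivity)
    filter_upwards [this] with w hw
    rwa [← dist_eq_norm]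
  obtain ⟨d, hd, hdb⟩ := Metric.eventually_nhds_iff.1 (hlift.and hcont)
  have hproj : ∀ w, Y.proj (F w - F 0) = Y.proj (F w) := fun w => by
    rw [map_sub, hF0, sub_zero]
  have hhalf : ∀ w : Fin g → ℂ, ‖w‖ < d →
      F w - F 0 = (2 : ℂ) • (F ((2 : ℂ)⁻¹ • w) - F 0) := by
    intro w hw
    have hw2 : ‖(2 : ℂ)⁻¹ • w‖ < d := by
      rw [norm_smul]; norm_num; linarith [norm_nonneg w]
    obtain ⟨h1, h2⟩ := hdb (y := w) (by simpa using hw)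
    obtain ⟨h3, h4⟩ := hdb (y := (2 : ℂ)⁻¹ • w) (by simpa using hw2)
    rw [← sub_eq_zero]
    apply hball
    · rw [← proj_eq_iff, hproj, ← h1, two_smul, map_add, hproj, ← h3, ← map_add, ← map_add,
        ← two_smul ℂ, smul_smul]
      norm_num
    · refine (norm_sub_le _ _).trans_lt ?_
      rw [norm_smul]
      norm_num
      linarith
  have hpow : ∀ n : ℕ, ∀ w : Fin g → ℂ, ‖w‖ < d →
      F w - F 0 = ((2 : ℂ) ^ n) • (F (((2 : ℂ) ^ n)⁻¹ • w) - F 0) := by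
    intro n
    induction n with
    | zero => intro w _; simp
    | succ n ih =>
      intro w hw
      have hwn : ‖((2 : ℂ) ^ n)⁻¹ • w‖ < d := by
        rw [norm_smul]
        refine lt_of_le_of_lt (mul_le_of_le_one_left (norm_nonneg w) ?_) hw
        rw [norm_inv, norm_pow]
        exact inv_le_one_of_one_le₀ (one_le_pow₀ (by norm_num))
      rw [ih w hw, hhalf _ hwn, smul_smul, smul_smul, pow_succ]
      congr 4
      rw [mul_inv_rev]
  set B := fderiv ℂ F 0 with hB
  have hlim : ∀ w, Filter.Tendsto
      (fun n : ℕ => ((2 : ℂ) ^ n) • (F (((2 : ℂ) ^ n)⁻¹ • w) - F 0)) Filter.atTop (𝓝 (B w)) := by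
    intro w
    have := (hF.differentiableAt.hasFDerivAt).lim w (c := fun n : ℕ => (2 : ℂ) ^ n)
      (l := Filter.atTop) (by
        simp only [norm_pow, Complex.norm_ofNat]
        exact tendsto_pow_atTop_atTop_of_one_lt (by norm_num))
    simpa using this
  have hlin : ∀ w : Fin g → ℂ, ‖w‖ < d → F w - F 0 = B w := by
    intro w hw
    refine tendsto_nhds_unique ?_ (hlim w)
    simp only [← hpow _ w hw]
    exact tendsto_const_nhds
  refine ⟨B, fun v => ?_⟩
  obtain ⟨n, hn⟩ : ∃ n : ℕ, ‖v‖ / d < (2 : ℝ) ^ n := pow_unbounded_of_one_lt _ (by norm_num)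
  have hvn : ‖((2 : ℂ) ^ n)⁻¹ • v‖ < d := by
    rw [norm_smul, norm_inv, norm_pow, Complex.norm_ofNat, inv_mul_lt_iff₀ (by positivity)]
    rwa [div_lt_iff₀ hd] at hn
  have hsm : ∀ {d : ℕ} (x : Fin d → ℂ), (2 ^ n : ℕ) • (((2 : ℂ) ^ n)⁻¹ • x) = x := by
    intro d x
    rw [← Nat.cast_smul_eq_nsmul ℂ, smul_smul]
    push_cast
    rw [mul_inv_cancel₀ (pow_ne_zero n two_ne_zero), one_smul]
  conv_lhs => rw [← hsm v]
  rw [map_nsmul, map_nsmul, (hdb (y := ((2 : ℂ) ^ n)⁻¹ • v) (by simpa using hvn)).1, ← hproj,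
    hlin _ hvn, map_smul]
  exact (map_nsmul Y.proj.toAddMonoidHom _ _).symm.trans (congrArg Y.proj (hsm (B v)))

theorem exists_analyticRep {X : ComplexTorus g} (f : X.endo) :
    ∃ A : Matrix (Fin g) (Fin g) ℂ, ∀ v, f.1 (X.proj v) = X.proj (A.mulVec v) := by
  obtain ⟨B, hB⟩ := exists_linear_lift f.1 f.2
  refine ⟨LinearMap.toMatrix' B.toLinearMap, fun v => ?_⟩
  refine (hB v).trans (congrArg X.proj ?_)
  rw [← Matrix.toLin'_apply, Matrix.toLin'_toMatrix']
  rfl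

/-- The analytic representation of an endomorphism: the matrix of the linear map `ℂ^g → ℂ^g`
which induces it. -/
noncomputable def analyticRep {X : ComplexTorus g} (f : X.endo) : Matrix (Fin g) (Fin g) ℂ :=
  (exists_analyticRep f).choose

theorem analyticRep_spec {X : ComplexTorus g} (f : X.endo) (v : Fin g → ℂ) :
    f.1 (X.proj v) = X.proj ((analyticRep f).mulVec v) :=
  (exists_analyticRep f).choose_spec v

theorem analyticRep_mem {X : ComplexTorus g} (f : X.endo) {l : Fin g → ℂ} (hl : l ∈ X.lattice) :
    (analyticRep f).mulVec l ∈ X.lattice := by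
  have h0 : X.proj l = X.proj 0 := (X.proj_eq_iff l 0).2 (by simpa using hl)
  have h := analyticRep_spec f l
  rw [h0, map_zero, map_zero] at h
  simpa using (X.proj_eq_iff _ 0).1 (h.symm.trans (map_zero _).symm)

/-! ### Dolbeault cohomology -/

/-- The space of smooth functions `X → ℂ`, as `Λ`-periodic smooth (in the real sense) functions
on `ℂ^g`. -/
def smoothSubmodule (X : ComplexTorus g) : Submodule ℂ ((Fin g → ℂ) → ℂ) where
  carrier := {u | ContDiff ℝ ∞ u ∧ ∀ l ∈ X.lattice, ∀ v, u (v + l) = u v}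
  zero_mem' := ⟨contDiff_const, fun _ _ _ => rfl⟩
  add_mem' := fun ha hb => ⟨ha.1.add hb.1, fun l hl v => by
    simp only [Pi.add_apply, ha.2 l hl v, hb.2 l hl v]⟩
  smul_mem' := fun c _ ha => ⟨ha.1.const_smul c, fun l hl v => by
    simp only [Pi.smul_apply, ha.2 l hl v]⟩

/-- The type of smooth functions `X → ℂ`. -/
def SmoothFun (X : ComplexTorus g) : Type := X.smoothSubmodule

instance (X : ComplexTorus g) : AddCommGroup X.SmoothFun :=
  inferInstanceAs (AddCommGroup X.smoothSubmodule)

instance (X : ComplexTorus g) : Module ℂ X.SmoothFun :=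
  inferInstanceAs (Module ℂ X.smoothSubmodule)

theorem SmoothFun.ext {X : ComplexTorus g} {u u' : X.SmoothFun} (h : ∀ v, u.1 v = u'.1 v) :
    u = u' :=
  Subtype.ext (funext h)

/-- The differential operator `∂/∂z̄_j = (∂/∂x_j + i ∂/∂y_j) / 2` on functions on `ℂ^g`, where
`z_j = x_j + i y_j`. -/
noncomputable def wirtingerBar (j : Fin g) (u : (Fin g → ℂ) → ℂ) (v : Fin g → ℂ) : ℂ :=
  (fderiv ℝ u v (Pi.single j 1) + Complex.I * fderiv ℝ u v (Pi.single j Complex.I)) / 2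

/-- The operator `∂/∂z̄_j` on smooth functions on the torus. -/
noncomputable def dzbar (X : ComplexTorus g) (j : Fin g) : X.SmoothFun →ₗ[ℂ] X.SmoothFun where
  toFun u := Subtype.mk (wirtingerBar j u.1) (by
    have hd : ContDiff ℝ ∞ (fderiv ℝ u.1) := (contDiff_infty_iff_fderiv.1 u.2.1).2
    refine ⟨?_, fun l hl v => ?_⟩
    · exact (((hd.clm_apply contDiff_const).add
        (contDiff_const.mul (hd.clm_apply contDiff_const))).div_const 2)
    · have hp : (fun w => u.1 (w + l)) = u.1 := funext (u.2.2 l hl)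
      have := fderiv_comp_add_right (𝕜 := ℝ) (f := u.1) (x := v) l
      rw [hp] at this
      simp only [wirtingerBar, this])
  map_add' u u' := by
    refine SmoothFun.ext fun v => ?_
    have h := (u.2.1.differentiable (by simp)).differentiableAt (x := v)
    have h' := (u'.2.1.differentiable (by simp)).differentiableAt (x := v)
    change wirtingerBar j (u.1 + u'.1) v = wirtingerBar j u.1 v + wirtingerBar j u'.1 v
    simp only [wirtingerBar, fderiv_add h h', add_apply]
    ring
  map_smul' c u := by
    refine SmoothFun.ext fun v => ?_
    have h := (u.2.1.differentiable (by simp)).differentiableAt (x := v)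
    change wirtingerBar j (c • u.1) v = c * wirtingerBar j u.1 v
    simp only [wirtingerBar, fderiv_const_smul h, smul_apply, smul_eq_mul]
    ring

/-- Smooth `(1,0)`-forms on the torus: `η` stands for `∑ i, η i • dz_i`. -/
abbrev Form10 (X : ComplexTorus g) : Type := Fin g → X.SmoothFun

/-- Smooth `(1,1)`-forms on the torus: `ψ` stands for `∑ i, ∑ j, ψ i j • dz_i ∧ dz̄_j`. -/
abbrev Form11 (X : ComplexTorus g) : Type := Fin g → Fin g → X.SmoothFun

/-- The operator `∂̄` from `(1,0)`-forms to `(1,1)`-forms: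
`∂̄ (∑ i, η i • dz_i) = ∑ i, ∑ j, (- ∂(η i)/∂z̄_j) • dz_i ∧ dz̄_j`. -/
noncomputable def dbar10 (X : ComplexTorus g) : X.Form10 →ₗ[ℂ] X.Form11 where
  toFun η := fun i j => - X.dzbar j (η i)
  map_add' η η' := by
    funext i j
    simp only [Pi.add_apply, map_add, neg_add]
  map_smul' c η := by
    funext i j
    simp only [Pi.smul_apply, map_smul, RingHom.id_apply, smul_neg]

/-- The operator `∂̄` from `(1,1)`-forms to `(1,2)`-forms. Since
`∂̄ (∑ i j, ψ i j • dz_i ∧ dz̄_j)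
  = ∑ i, ∑_{j < k}, (∂(ψ i j)/∂z̄_k - ∂(ψ i k)/∂z̄_j) • dz̄_k ∧ dz_i ∧ dz̄_j`, a `(1,2)`-form is
recorded by its family of coefficients (antisymmetric in `j`, `k`). -/
noncomputable def dbar11 (X : ComplexTorus g) :
    X.Form11 →ₗ[ℂ] (Fin g → Fin g → Fin g → X.SmoothFun) where
  toFun ψ := fun i j k => X.dzbar k (ψ i j) - X.dzbar j (ψ i k)
  map_add' ψ ψ' := by
    funext i j k
    simp only [Pi.add_apply, map_add]
    abel
  map_smul' c ψ := by
    funext i j k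
    simp only [Pi.smul_apply, map_smul, RingHom.id_apply, smul_sub]

/-- The Dolbeault cohomology `H^{1,1}(X)`: the `∂̄`-closed `(1,1)`-forms modulo the `∂̄`-exact
ones. -/
abbrev H11 (X : ComplexTorus g) : Type :=
  LinearMap.ker X.dbar11 ⧸ (LinearMap.range X.dbar10).submoduleOf (LinearMap.ker X.dbar11)

/-! ### Pull-back -/

/-- The pull-back of smooth functions by an endomorphism. -/
noncomputable def pullFun {X : ComplexTorus g} (f : X.endo) : X.SmoothFun →ₗ[ℂ] X.SmoothFun where
  toFun u := Subtype.mk (fun v => u.1 ((analyticRep f).mulVec v)) (by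
    refine ⟨u.2.1.comp ?_, fun l hl v => ?_⟩
    · exact ((LinearMap.toContinuousLinearMap
        (Matrix.mulVecLin (analyticRep f))).restrictScalars ℝ).contDiff
    · change u.1 _ = u.1 _
      rw [Matrix.mulVec_add]
      exact u.2.2 _ (analyticRep_mem f hl) _)
  map_add' _ _ := rfl
  map_smul' _ _ := rfl

theorem dzbar_pullFun {X : ComplexTorus g} (f : X.endo) (l : Fin g) (u : X.SmoothFun) :
    X.dzbar l (pullFun f u) =
      ∑ j, star (analyticRep f j l) • pullFun f (X.dzbar j u) := by
  refine SmoothFun.ext fun v => ?_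
  set A := analyticRep f with hA
  let M : (Fin g → ℂ) →L[ℝ] (Fin g → ℂ) :=
    (LinearMap.toContinuousLinearMap (Matrix.mulVecLin A)).restrictScalars ℝ
  have hM : ∀ w, M w = A.mulVec w := fun _ => rfl
  have hu := (u.2.1.differentiable (by simp)).differentiableAt (x := M v)
  have hcomp : fderiv ℝ (fun v => u.1 (A.mulVec v)) v = (fderiv ℝ u.1 (M v)).comp M :=
    (hu.hasFDerivAt.comp v M.hasFDerivAt).fderiv
  have hvec : ∀ c : ℂ, M (Pi.single l c) = ∑ j, ((c * A j l).re • (Pi.single j 1 : Fin g → ℂ)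
      + (c * A j l).im • (Pi.single j Complex.I : Fin g → ℂ)) := by
    intro c
    rw [hM]
    ext i
    simp only [Finset.sum_apply, Pi.add_apply, Pi.smul_apply, Pi.single_apply]
    simp only [smul_ite, smul_zero, Finset.sum_add_distrib, Finset.sum_ite_eq,
      Finset.mem_univ, if_true]
    rw [Matrix.mulVec_single]
    simp only [Pi.smul_apply, Matrix.col_apply, MulOpposite.smul_eq_mul_unop,
      MulOpposite.unop_op, Complex.real_smul, mul_one]
    rw [Complex.re_add_im, mul_comm]
  have hsum : (∑ j, star (A j l) • pullFun f (X.dzbar j u)).1 v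
      = ∑ j, star (A j l) * wirtingerBar j u.1 (M v) := by
    refine (congrFun (map_sum X.smoothSubmodule.subtype
      (fun j => star (A j l) • pullFun f (X.dzbar j u)) Finset.univ) v).trans ?_
    rw [Finset.sum_apply]
    rfl
  rw [hsum]
  change wirtingerBar l (fun v => u.1 (A.mulVec v)) v = _
  rw [wirtingerBar, hcomp]
  simp only [ContinuousLinearMap.comp_apply, hvec, map_sum, map_add, map_smul]
  rw [Finset.mul_sum, ← Finset.sum_add_distrib, Finset.sum_div]
  refine Finset.sum_congr rfl fun j _ => ?_
  have hst : star (A j l) = ((A j l).re : ℂ) - (A j l).im * Complex.I := by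
    apply Complex.ext <;> simp
  rw [wirtingerBar, hst]
  simp only [one_mul, Complex.I_mul_re, Complex.I_mul_im, Complex.real_smul]
  push_cast
  linear_combination ((A j l).im * fderiv ℝ u.1 (M v) (Pi.single j Complex.I) / 2)
    * Complex.I_sq

/-- The pull-back of `(1,0)`-forms: `f^* dz_i = ∑ k, A i k • dz_k`, where `A` is the analytic
representation of `f`. -/
noncomputable def pull10 {X : ComplexTorus g} (f : X.endo) (η : X.Form10) : X.Form10 :=
  fun k => ∑ i, analyticRep f i k • pullFun f (η i)

/-- The pull-back of `(1,1)`-forms: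
`f^* (dz_i ∧ dz̄_j) = ∑ k, ∑ l, (A i k * conj (A j l)) • dz_k ∧ dz̄_l`, where `A` is the analytic
representation of `f`. -/
noncomputable def pull11 {X : ComplexTorus g} (f : X.endo) : X.Form11 →ₗ[ℂ] X.Form11 where
  toFun ψ := fun k l =>
    ∑ i, ∑ j, (analyticRep f i k * star (analyticRep f j l)) • pullFun f (ψ i j)
  map_add' ψ ψ' := by
    funext k l
    simp only [Pi.add_apply, map_add, smul_add, Finset.sum_add_distrib]
  map_smul' c ψ := by
    funext k l
    simp only [Pi.smul_apply, map_smul, RingHom.id_apply, Finset.smul_sum]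
    refine Finset.sum_congr rfl fun i _ => Finset.sum_congr rfl fun j _ => smul_comm _ _ _

theorem pull11_dbar10 {X : ComplexTorus g} (f : X.endo) (η : X.Form10) :
    pull11 f (X.dbar10 η) = X.dbar10 (pull10 f η) := by
  funext k l
  simp only [pull11, dbar10, pull10, LinearMap.coe_mk, AddHom.coe_mk, map_sum, map_smul,
    dzbar_pullFun, map_neg, smul_neg, Finset.sum_neg_distrib, Finset.smul_sum, smul_smul]

theorem pull11_mem_ker {X : ComplexTorus g} (f : X.endo) (ψ : X.Form11)
    (hψ : ψ ∈ LinearMap.ker X.dbar11) : pull11 f ψ ∈ LinearMap.ker X.dbar11 := by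
  rw [LinearMap.mem_ker] at hψ ⊢
  have hc : ∀ i j m, X.dzbar m (ψ i j) = X.dzbar j (ψ i m) := fun i j m =>
    sub_eq_zero.1 (congrFun (congrFun (congrFun hψ i) j) m)
  funext k l m
  simp only [pull11, dbar11, LinearMap.coe_mk, AddHom.coe_mk, map_sum, map_smul,
    dzbar_pullFun, Finset.smul_sum, smul_smul, Pi.zero_apply]
  rw [sub_eq_zero]
  refine Finset.sum_congr rfl fun i _ => ?_
  rw [Finset.sum_comm]
  refine Finset.sum_congr rfl fun a _ => Finset.sum_congr rfl fun b _ => ?_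
  rw [hc i b a]
  congr 1
  ring

/-- The linear map `f^* : H^{1,1}(X) → H^{1,1}(X)`. -/
noncomputable def pullH11 {X : ComplexTorus g} (f : X.endo) : Module.End ℂ X.H11 :=
  Submodule.mapQ _ _ ((pull11 f).restrict (pull11_mem_ker f)) (by
    rintro ⟨ψ, hψ⟩ ⟨η, hη⟩
    exact ⟨pull10 f η, by rw [← pull11_dbar10, hη]; rfl⟩)

/-- `lam` is the first dynamical degree of `f`: the limit of `‖(f^n)^*‖^(1/n)`, where `(f^n)^*` acts
on `H^{1,1}(X)` and `‖·‖` is any norm on the space of linear endomorphisms of `H^{1,1}(X)`. -/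
def IsFirstDynamicalDegree {X : ComplexTorus g} (f : X.endo) (lam : ℝ) : Prop :=
  ∀ N : Seminorm ℂ (Module.End ℂ X.H11), (∀ T, N T = 0 → T = 0) →
    Filter.Tendsto (fun n : ℕ => N (pullH11 (f ^ n)) ^ (1 / (n : ℝ))) Filter.atTop (𝓝 lam)

end ComplexTorus

/-- The first dynamical degrees, other than `1`, of surjective endomorphisms of `g`-dimensional
complex abelian varieties. -/
def degreesA (g : ℕ) : Set ℝ :=
  {lam | ∃ X : ComplexTorus g, X.IsAbelianVariety ∧
    ∃ f : X.endo, Function.Surjective f.1 ∧ ComplexTorus.IsFirstDynamicalDegree f lam} \ {1}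

/-- The first dynamical degrees, other than `1`, of automorphisms (endomorphisms which have an
inverse endomorphism) of `g`-dimensional simple complex abelian varieties. -/
def degreesB (g : ℕ) : Set ℝ :=
  {lam | ∃ X : ComplexTorus g, X.IsAbelianVariety ∧ X.IsSimple ∧
    ∃ f : X.endo, IsUnit f ∧ ComplexTorus.IsFirstDynamicalDegree f lam} \ {1}

/-!
The first dynamical degree of an endomorphism `f` of a complex torus `X = ℂ^g / Λ` is `ρ(A) ^ 2`,
where `A` is the analytic representation of `f` and `ρ` is the spectral radius. Indeed, Fourier
series identify `H^{1,1}(X)` with the space of `(1,1)`-forms with constant coefficients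
(`ComplexTorus.constClassEquiv`): a `∂̄`-closed form becomes constant after subtracting `∂̄ u`, where
`u` is found by dividing Fourier coefficients by symbols which are bounded away from zero. On
constant forms `f^*` has the matrix entries `A i k * conj (A j l)`, so that any norm of `(f^n)^*`
grows like `‖A ^ n‖ ^ 2`, and Gelfand's formula applies (`ComplexTorus.isFirstDynamicalDegree_iff`).

The spectral radius of `A` is also that of the integer matrix of size `2 g` by which `f` acts on
`Λ`. Monic integer polynomials of given degree with bounded roots are finite in number, so there are
only finitely many dynamical degrees below any bound
(`ComplexTorus.finite_firstDynamicalDegree_le`), and a nonempty set of them has a minimum. As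
automorphisms are surjective, it remains to find one simple abelian variety of dimension `g` with an
automorphism whose first dynamical degree is not `1`.

For this, let `T` be the companion matrix of Pólya's polynomial `∏ (x - 4 i) - 1`, `0 ≤ i < g`. The
polynomial is irreducible over `ℚ`, has `g` real roots, one of them greater than `2`, and its
constant coefficient is `-1`, so that `T` is unimodular; moreover `T` is self-adjoint with respect to
the trace form `G`, an integral inner product (`Matrix.exists_unimodular_selfAdjoint`). Consider the
torus with lattice `ℤ^g + τ ℤ^g`, where `τ = i (y ^ 2 + 1) / y - (y ^ 2 + 1) T` and `y > 0` is
transcendental. A multiple of `G` is a polarization, and `T` acts as an automorphism with an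
eigenvalue outside the unit circle.

The torus is simple: up to the factor `s = i y`, the period map `(a, b) ↦ a + τ b` is the value at
`s` of the pencil `s a + (s ^ 2 - 1) (b + s T b)`. An abelian subvariety of dimension `m` gives a
rational space `W` of pairs `(a, b)`, of dimension at least `2 m`, which the pencil at `s` maps into a
complex space of dimension `m`. Since `s` is transcendental, the pencil at each rational number then
has rank at most `m` on `W`. The values `0` and `1` show that `W` is a product `U₁ × U₂` of spaces
of dimension `m`, and the values `2` and `-2` show that `U₁ = U₂` is stable under `T`, hence trivial
(`TranscendentalSpecialization.finrank_eq_zero_or_eq`).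
-/

/-! ### Fourier analysis on a torus -/

namespace TorusFourier

open MeasureTheory Module

variable {ι E : Type*} [NormedAddCommGroup E] [NormedSpace ℝ E]

/-- Invariance of a function on a real vector space under translation by the lattice spanned by the
basis `b`. -/
def IsPeriodic (b : Basis ι ℝ E) (u : E → ℂ) : Prop :=
  ∀ l ∈ Submodule.span ℤ (Set.range b), ∀ v, u (v + l) = u v

/-- The projection of a real vector space onto its quotient by the lattice spanned by the basis
`b`, the quotient being identified with `(ℝ / ℤ)^ι` by means of the coordinates. -/
noncomputable def toTorus (b : Basis ι ℝ E) (v : E) : UnitAddTorus ι :=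
  fun i => (b.repr v i : UnitAddCircle)

theorem toTorus_add (b : Basis ι ℝ E) (v w : E) :
    toTorus b (v + w) = toTorus b v + toTorus b w := by
  funext i
  simp [toTorus]

theorem sub_mem_of_toTorus_eq (b : Basis ι ℝ E) {v w : E} (h : toTorus b v = toTorus b w) :
    v - w ∈ Submodule.span ℤ (Set.range b) := by
  rw [b.mem_span_iff_repr_mem ℤ]
  intro i
  have hi := congrFun h i
  simp only [toTorus] at hi
  rw [← sub_eq_zero, ← AddCircle.coe_sub, AddCircle.coe_eq_zero_iff] at hi
  obtain ⟨n, hn⟩ := hi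
  exact ⟨n, by simpa using hn⟩

theorem IsPeriodic.apply_eq {b : Basis ι ℝ E} {u : E → ℂ} (hu : IsPeriodic b u) {v w : E}
    (h : toTorus b v = toTorus b w) : u v = u w := by
  have := hu _ (sub_mem_of_toTorus_eq b h) w
  rwa [add_sub_cancel] at this

theorem IsPeriodic.fderiv {b : Basis ι ℝ E} {u : E → ℂ} (hu : IsPeriodic b u) (a : E) : IsPeriodic b fun v => fderiv ℝ u v a := by
  intro l hl v
  have hp : (fun w => u (w + l)) = u := funext (hu l hl)
  have := fderiv_comp_add_right (𝕜 := ℝ) (f := u) (x := v) l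
  rw [hp] at this
  exact congrArg (fun L => L a) this.symm

theorem IsPeriodic.mul {b : Basis ι ℝ E} {u w : E → ℂ} (hu : IsPeriodic b u) (hw : IsPeriodic b w) :
    IsPeriodic b fun v => u v * w v :=
  fun l hl v => by simp only [hu l hl, hw l hl]

variable [Fintype ι]

theorem isOpenQuotientMap_toTorus [FiniteDimensional ℝ E] (b : Basis ι ℝ E) :
    IsOpenQuotientMap (toTorus b) := by
  have h1 : IsOpenQuotientMap (Pi.map fun (_ : ι) (x : ℝ) => (x : UnitAddCircle)) :=
    IsOpenQuotientMap.piMap fun _ => QuotientAddGroup.isOpenQuotientMap_mk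
  have h2 : IsOpenQuotientMap b.equivFunL := b.equivFunL.toHomeomorph.isOpenQuotientMap
  exact h1.comp h2

/-- A (non-continuous) section of the projection onto the torus, used to view periodic functions as
functions on the torus. -/
noncomputable def lift [FiniteDimensional ℝ E] (b : Basis ι ℝ E) : UnitAddTorus ι → E :=
  Function.surjInv (isOpenQuotientMap_toTorus b).surjective

variable [FiniteDimensional ℝ E] {b : Basis ι ℝ E} {u w : E → ℂ}

theorem toTorus_lift (t : UnitAddTorus ι) : toTorus b (lift b t) = t :=
  Function.surjInv_eq _ t

theorem IsPeriodic.apply_lift (hu : IsPeriodic b u) (v : E) : u (lift b (toTorus b v)) = u v :=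
  hu.apply_eq (toTorus_lift _)

theorem IsPeriodic.continuous_lift (hu : IsPeriodic b u) (hc : Continuous u) :
    Continuous fun t => u (lift b t) := by
  rw [(isOpenQuotientMap_toTorus b).isQuotientMap.continuous_iff]
  convert hc using 1
  exact funext hu.apply_lift

theorem IsPeriodic.bounded (hu : IsPeriodic b u) (hc : Continuous u) : ∃ C, ∀ v, ‖u v‖ ≤ C := by
  obtain ⟨C, hC⟩ := isCompact_univ.exists_bound_of_continuousOn
    (hu.continuous_lift hc).continuousOn
  exact ⟨C, fun v => hu.apply_lift v ▸ hC _ (Set.mem_univ _)⟩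

/-- The mean value of a periodic function. -/
noncomputable def avg (b : Basis ι ℝ E) (u : E → ℂ) : ℂ :=
  ∫ t : UnitAddTorus ι, u (lift b t)

theorem IsPeriodic.integrable (hu : IsPeriodic b u) (hc : Continuous u) :
    Integrable fun t : UnitAddTorus ι => u (lift b t) :=
  (hu.continuous_lift hc).integrable_of_hasCompactSupport (HasCompactSupport.of_compactSpace _)

theorem avg_translate (hu : IsPeriodic b u) (a : E) : avg b (fun v => u (v + a)) = avg b u := by
  have h : ∀ t, u (lift b t + a) = u (lift b (t + toTorus b a)) := fun t =>
    hu.apply_eq (by rw [toTorus_add, toTorus_lift, toTorus_lift])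
  simp only [avg, h]
  exact integral_add_right_eq_self (fun t => u (lift b t)) (toTorus b a)

/-- The mean value is invariant under translations, hence derivatives have mean value zero. -/
theorem avg_fderiv (hu : IsPeriodic b u) (hd : ContDiff ℝ 1 u) (a : E) :
    avg b (fun v => fderiv ℝ u v a) = 0 := by
  have hc' : Continuous fun v => fderiv ℝ u v a :=
    (hd.continuous_fderiv (by simp)).clm_apply continuous_const
  obtain ⟨C, hC⟩ := (hu.fderiv a).bounded hc'
  have htr : ∀ s : ℝ, IsPeriodic b fun v => u (v + s • a) := fun s l hl v => by
    simp only [add_right_comm v l, hu l hl]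
  have hderiv := (hasDerivAt_integral_of_dominated_loc_of_deriv_le (μ := volume)
    (F := fun (s : ℝ) (t : UnitAddTorus ι) => u (lift b t + s • a))
    (F' := fun (s : ℝ) (t : UnitAddTorus ι) => fderiv ℝ u (lift b t + s • a) a)
    (x₀ := 0) (s := Set.univ) (bound := fun _ => C) Filter.univ_mem
    (Filter.Eventually.of_forall fun s => ((htr s).continuous_lift
      (hd.continuous.comp (continuous_id.add continuous_const))).aestronglyMeasurable)
    ((htr 0).integrable (hd.continuous.comp (continuous_id.add continuous_const)))
    (by
      simp only [zero_smul, add_zero]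
      exact ((hu.fderiv a).continuous_lift hc').aestronglyMeasurable)
    (Filter.Eventually.of_forall fun t s _ => hC _) (integrable_const C)
    (Filter.Eventually.of_forall fun t s _ => by
      have h1 := ((hd.differentiable (by simp)) (lift b t + s • a)).hasFDerivAt
      have h2 : HasDerivAt (fun s : ℝ => lift b t + s • a) a s := by
        simpa using ((hasDerivAt_id s).smul_const a).const_add (lift b t)
      exact h1.comp_hasDerivAt s h2)).2
  -- by invariance under translations, the function of `s` under consideration is constant
  have hconst : (fun s : ℝ => ∫ t : UnitAddTorus ι, u (lift b t + s • a)) = fun _ => avg b u :=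
    funext fun s => avg_translate hu (s • a)
  rw [hconst] at hderiv
  simpa [avg] using hderiv.unique (hasDerivAt_const (0 : ℝ) (avg b u))

theorem volume_real_univ : (volume : Measure (UnitAddTorus ι)).real Set.univ = 1 := by
  have h : (volume : Measure (UnitAddTorus ι)) Set.univ = 1 := by
    change (Measure.pi fun _ : ι => (volume : Measure UnitAddCircle)) Set.univ = 1
    rw [Measure.pi_univ]
    simp
  rw [measureReal_def, h, ENNReal.toReal_one]

theorem avg_const (c : ℂ) : avg b (fun _ => c) = c := by
  simp [avg, volume_real_univ]

theorem avg_add (hu : IsPeriodic b u) (hc : Continuous u) (hw : IsPeriodic b w)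
    (hc' : Continuous w) : avg b (fun v => u v + w v) = avg b u + avg b w :=
  integral_add (hu.integrable hc) (hw.integrable hc')

theorem avg_const_mul (c : ℂ) (u : E → ℂ) : avg b (fun v => c * u v) = c * avg b u :=
  integral_const_mul _ _

theorem norm_avg_le {C : ℝ} (h : ∀ v, ‖u v‖ ≤ C) : ‖avg b u‖ ≤ C := by
  have := norm_integral_le_of_norm_le_const (μ := (volume : Measure (UnitAddTorus ι)))
    (f := fun t => u (lift b t)) (Filter.Eventually.of_forall fun t => h _)
  exact this.trans_eq (by rw [volume_real_univ, mul_one])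

/-- The real linear form with coordinates `n` with respect to the basis `b`. -/
noncomputable def freq (b : Basis ι ℝ E) (n : ι → ℝ) : E →L[ℝ] ℝ :=
  ∑ i, n i • LinearMap.toContinuousLinearMap (b.coord i)

theorem freq_apply (n : ι → ℝ) (v : E) : freq b n v = ∑ i, n i * b.repr v i := by
  simp [freq]

theorem freq_basis (n : ι → ℝ) (i : ι) : freq b n (b i) = n i := by
  classical
  simp [freq_apply, Finsupp.single_apply]

/-- The character of the torus with frequency `n`. -/
noncomputable def chi (b : Basis ι ℝ E) (n : ι → ℤ) (v : E) : ℂ :=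
  Complex.exp (2 * Real.pi * Complex.I * (freq b (fun i => n i) v : ℂ))

theorem chi_eq_mFourier (n : ι → ℤ) (v : E) :
    chi b n v = UnitAddTorus.mFourier n (toTorus b v) := by
  simp only [chi, UnitAddTorus.mFourier, ContinuousMap.coe_mk, toTorus, fourier_coe_apply,
    freq_apply, ← Complex.exp_sum]
  congr 1
  push_cast
  rw [Finset.mul_sum]
  refine Finset.sum_congr rfl fun i _ => ?_
  ring

theorem isPeriodic_chi (n : ι → ℤ) : IsPeriodic b (chi b n) := by
  intro l hl v
  rw [b.mem_span_iff_repr_mem ℤ] at hl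
  rw [chi_eq_mFourier, chi_eq_mFourier, toTorus_add]
  have : toTorus b l = 0 := by
    funext i
    obtain ⟨k, hk⟩ := hl i
    simp only [toTorus, ← hk, Pi.zero_apply]
    exact (AddCircle.coe_eq_zero_iff 1).2 ⟨k, by simp⟩
  rw [this, add_zero]

theorem contDiff_chi (n : ι → ℤ) : ContDiff ℝ ∞ (chi b n) := by
  unfold chi
  have := (freq b fun i => (n i : ℝ)).contDiff (n := ∞)
  have h2 : ContDiff ℝ ∞ fun v => ((freq b (fun i => (n i : ℝ)) v : ℝ) : ℂ) :=
    Complex.ofRealCLM.contDiff.comp this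
  exact (contDiff_const.mul h2).cexp

theorem norm_chi (n : ι → ℤ) (v : E) : ‖chi b n v‖ = 1 := by
  rw [chi, show 2 * Real.pi * Complex.I * (freq b (fun i => (n i : ℝ)) v : ℂ)
    = ((2 * Real.pi * freq b (fun i => (n i : ℝ)) v : ℝ) : ℂ) * Complex.I by push_cast; ring]
  exact Complex.norm_exp_ofReal_mul_I _

theorem chi_add_freq (m n : ι → ℤ) (v : E) : chi b (m + n) v = chi b m v * chi b n v := by
  rw [chi_eq_mFourier, chi_eq_mFourier, chi_eq_mFourier, UnitAddTorus.mFourier_add]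

theorem chi_zero (v : E) : chi b (0 : ι → ℤ) v = 1 := by
  rw [chi_eq_mFourier, UnitAddTorus.mFourier_zero]; rfl

theorem fderiv_chi (n : ι → ℤ) (v a : E) :
    fderiv ℝ (chi b n) v a
      = 2 * Real.pi * Complex.I * (freq b (fun i => n i) a : ℂ) * chi b n v := by
  have h1 : HasFDerivAt (fun v => ((freq b (fun i => (n i : ℝ)) v : ℝ) : ℂ))
      (Complex.ofRealCLM.comp (freq b fun i => (n i : ℝ))) v :=
    (Complex.ofRealCLM.comp (freq b fun i => (n i : ℝ))).hasFDerivAt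
  have h2 := (h1.const_mul (2 * Real.pi * Complex.I)).cexp
  have : chi b n = fun v => Complex.exp (2 * Real.pi * Complex.I
    * ((freq b (fun i => (n i : ℝ)) v : ℝ) : ℂ)) := rfl
  rw [this, h2.fderiv]
  simp
  ring

/-- The Fourier coefficients of a periodic function. -/
noncomputable def coeff (b : Basis ι ℝ E) (n : ι → ℤ) (u : E → ℂ) : ℂ :=
  avg b fun v => chi b (-n) v * u v

theorem coeff_fderiv (hu : IsPeriodic b u) (hd : ContDiff ℝ 1 u) (n : ι → ℤ) (a : E) :
    coeff b n (fun v => fderiv ℝ u v a)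
      = 2 * Real.pi * Complex.I * (freq b (fun i => n i) a : ℂ) * coeff b n u := by
  have hχ : ContDiff ℝ 1 (chi b (-n)) := (contDiff_chi _).of_le (by simp)
  have h0 := avg_fderiv ((isPeriodic_chi (-n)).mul hu) (hχ.mul hd) a
  have hfd : (fun v => fderiv ℝ (fun v => chi b (-n) v * u v) v a) =
      fun v => (chi b (-n) v * fderiv ℝ u v a) +
        (-(2 * Real.pi * Complex.I * (freq b (fun i => n i) a : ℂ))) * (chi b (-n) v * u v) := by
    funext v
    rw [fderiv_fun_mul (hχ.differentiable (by simp) v) (hd.differentiable (by simp) v)]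
    simp only [add_apply, smul_apply, smul_eq_mul, fderiv_chi]
    have : (freq b (fun i => (((-n) i : ℤ) : ℝ)) a) = - freq b (fun i => (n i : ℝ)) a := by
      simp [freq_apply]
    rw [this]
    push_cast
    ring
  have hcd : Continuous fun v => fderiv ℝ u v a :=
    (hd.continuous_fderiv (by simp)).clm_apply continuous_const
  rw [hfd, avg_add (w := fun v => (-(2 * Real.pi * Complex.I * (freq b (fun i => n i) a : ℂ)))
      * (chi b (-n) v * u v)) ((isPeriodic_chi (-n)).mul (hu.fderiv a)) (hχ.continuous.mul hcd)
    (fun l hl v => by simp only [hu l hl, isPeriodic_chi (-n) l hl])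
    (continuous_const.mul (hχ.continuous.mul hd.continuous)), avg_const_mul] at h0
  rw [coeff, coeff]
  linear_combination h0

theorem coeff_zero (u : E → ℂ) : coeff b 0 u = avg b u := by
  simp [coeff, chi_zero]

theorem coeff_add (hu : IsPeriodic b u) (hc : Continuous u) (hw : IsPeriodic b w)
    (hc' : Continuous w) (n : ι → ℤ) :
    coeff b n (fun v => u v + w v) = coeff b n u + coeff b n w := by
  have h := (contDiff_chi (b := b) (-n)).continuous
  simp only [coeff, mul_add]
  exact avg_add ((isPeriodic_chi _).mul hu) (h.mul hc) ((isPeriodic_chi _).mul hw) (h.mul hc')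

theorem coeff_const_mul (c : ℂ) (u : E → ℂ) (n : ι → ℤ) :
    coeff b n (fun v => c * u v) = c * coeff b n u := by
  simp only [coeff, mul_left_comm _ c]
  exact avg_const_mul _ _

theorem coeff_const (c : ℂ) {n : ι → ℤ} (hn : n ≠ 0) : coeff b n (fun _ => c) = 0 := by
  obtain ⟨i, hi⟩ := Function.ne_iff.1 hn
  have h := coeff_fderiv (b := b) (u := fun _ => c) (fun _ _ _ => rfl) contDiff_const n (b i)
  have h0 : coeff b n (fun v => fderiv ℝ (fun _ : E => c) v (b i)) = 0 := by
    simp [coeff, avg]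
  rw [h0, freq_basis] at h
  have hi' : n i ≠ 0 := hi
  simpa [Real.pi_ne_zero, Complex.I_ne_zero, hi'] using h.symm

/-- A continuous periodic function all of whose Fourier coefficients vanish is zero. -/
theorem eq_zero_of_coeff_eq_zero (hu : IsPeriodic b u) (hc : Continuous u)
    (h : ∀ n, coeff b n u = 0) (v : E) : u v = 0 := by
  let f : C(UnitAddTorus ι, ℂ) := ⟨fun t => u (lift b t), hu.continuous_lift hc⟩
  have hint : ∀ g : C(UnitAddTorus ι, ℂ), Integrable (fun t => g t * f t) := fun g =>
    (g.continuous.mul f.continuous).integrable_of_hasCompactSupport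
      (HasCompactSupport.of_compactSpace _)
  let L : C(UnitAddTorus ι, ℂ) →L[ℂ] ℂ := LinearMap.mkContinuous
    { toFun := fun g => ∫ t, g t * f t
      map_add' := fun g g' => by
        simp only [ContinuousMap.add_apply, add_mul]
        exact integral_add (hint g) (hint g')
      map_smul' := fun c g => by
        simp only [ContinuousMap.smul_apply, smul_eq_mul, mul_assoc]
        exact integral_const_mul _ _ } ‖f‖ fun g => by
      refine (norm_integral_le_of_norm_le_const (C := ‖f‖ * ‖g‖)
        (Filter.Eventually.of_forall fun t => ?_)).trans_eq (by rw [volume_real_univ, mul_one])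
      rw [norm_mul, mul_comm]
      exact mul_le_mul (f.norm_coe_le_norm t) (g.norm_coe_le_norm t) (norm_nonneg _) (norm_nonneg _)
  let S : Submodule ℂ C(UnitAddTorus ι, ℂ) := L.ker
  -- `S` is closed and contains all trigonometric polynomials, hence the conjugate of `f`
  have hScl : IsClosed (S : Set C(UnitAddTorus ι, ℂ)) := L.isClosed_ker
  have htop : S = ⊤ := by
    rw [eq_top_iff, ← UnitAddTorus.span_mFourier_closure_eq_top (d := ι)]
    refine Submodule.topologicalClosure_minimal _ ?_ hScl
    rw [Submodule.span_le]
    rintro _ ⟨n, rfl⟩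
    have := h (-n)
    simp only [coeff, avg, chi_eq_mFourier, toTorus_lift, neg_neg] at this
    exact this
  have hstar : star f ∈ S := htop ▸ Submodule.mem_top
  have hsq : ∫ t, ‖f t‖ ^ 2 = 0 := by
    have h1 : ∫ t, (star f) t * f t = 0 := hstar
    have h2 : ∀ t, (star f) t * f t = ((‖f t‖ ^ 2 : ℝ) : ℂ) := fun t => by
      rw [ContinuousMap.star_apply, mul_comm]
      simpa using Complex.mul_conj' (f t)
    simp only [h2] at h1
    rw [integral_complex_ofReal] at h1
    exact_mod_cast h1
  have hzero := (Continuous.integral_pos_of_hasCompactSupport_nonneg_nonzero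
    (μ := (volume : Measure (UnitAddTorus ι))) (f := fun t => ‖f t‖ ^ 2)
    (f.continuous.norm.pow 2) (HasCompactSupport.of_compactSpace _) (fun t => by positivity)
    (x := toTorus b v)).mt
  have := hzero
  rw [hsq] at this
  have := this (lt_irrefl _)
  have h3 : f (toTorus b v) = 0 := by simpa using this
  rw [← hu.apply_lift v]
  exact h3

theorem coord_pow_mul_norm_coeff_le (i : ι) (k : ℕ) : ∀ {u : E → ℂ}, IsPeriodic b u →
    ContDiff ℝ ∞ u → ∃ C, ∀ n : ι → ℤ, ‖n i‖ ^ k * ‖coeff b n u‖ ≤ C := by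
  induction k with
  | zero =>
    intro u hu hd
    obtain ⟨C, hC⟩ := hu.bounded hd.continuous
    refine ⟨C, fun n => ?_⟩
    rw [pow_zero, one_mul]
    exact norm_avg_le fun v => by rw [norm_mul, norm_chi, one_mul]; exact hC v
  | succ k ih =>
    intro u hu hd
    have hd' : ContDiff ℝ ∞ fun v => fderiv ℝ u v (b i) :=
      (contDiff_infty_iff_fderiv.1 hd).2.clm_apply contDiff_const
    obtain ⟨C, hC⟩ := ih (hu.fderiv (b i)) hd'
    refine ⟨C, fun n => le_trans ?_ (hC n)⟩
    rw [coeff_fderiv hu (hd.of_le (by simp)), freq_basis, norm_mul, pow_succ, mul_assoc]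
    refine mul_le_mul_of_nonneg_left (mul_le_mul_of_nonneg_right ?_ (norm_nonneg _))
      (by positivity)
    simp only [norm_mul, Complex.norm_ofNat, Complex.norm_real, Complex.norm_I, mul_one,
      Real.norm_eq_abs, abs_of_pos Real.pi_pos, Int.norm_eq_abs]
    nlinarith [Real.pi_gt_three, abs_nonneg (n i : ℝ)]

/-- Fast decay, at infinity of `ℤ^ι`: faster than every power of the norm. -/
def RapidDecay (d : (ι → ℤ) → ℂ) : Prop :=
  ∀ k : ℕ, ∃ C, ∀ n, ‖n‖ ^ k * ‖d n‖ ≤ C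

theorem rapidDecay_coeff (hu : IsPeriodic b u) (hd : ContDiff ℝ ∞ u) :
    RapidDecay fun n => coeff b n u := by
  intro k
  cases isEmpty_or_nonempty ι with
  | inl h => exact ⟨‖(0 : ι → ℤ)‖ ^ k * ‖coeff b 0 u‖, fun n => by rw [Subsingleton.elim n 0]⟩
  | inr h =>
    choose C hC using fun i => coord_pow_mul_norm_coeff_le (b := b) i k hu hd
    refine ⟨∑ i, C i, fun n => ?_⟩
    obtain ⟨i, -, hi'⟩ := Finset.exists_max_image Finset.univ (fun i => ‖n i‖) Finset.univ_nonempty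
    have hi : ‖n i‖ = ‖n‖ := le_antisymm (norm_le_pi_norm n i)
      ((pi_norm_le_iff_of_nonneg (norm_nonneg _)).2 fun j => hi' j (Finset.mem_univ j))
    rw [← hi]
    refine (hC i n).trans (Finset.single_le_sum (f := C) (fun j _ => ?_) (Finset.mem_univ i))
    exact le_trans (by positivity) (hC j 0)

theorem summable_norm_inv_pow {k : ℕ} (hk : Fintype.card ι < k) :
    Summable fun n : ι → ℤ => ‖n‖⁻¹ ^ k := by
  classical
  let e := Pi.basisFun ℝ ι
  let L := Submodule.span ℤ (Set.range e)
  have hrank : finrank ℤ L = Fintype.card ι := by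
    rw [ZLattice.rank ℝ L, finrank_fintype_fun_eq_card]
  have hmem : ∀ n : ι → ℤ, (fun i => (n i : ℝ)) ∈ L := fun n => by
    rw [e.mem_span_iff_repr_mem ℤ]
    exact fun i => ⟨n i, by simp [e]⟩
  have h := ZLattice.summable_norm_pow_inv L k (by rw [hrank]; exact hk)
  have hinj : Function.Injective fun n : ι → ℤ => (⟨_, hmem n⟩ : L) := fun n n' hn => by
    funext i
    simpa using congrFun (congrArg Subtype.val hn) i
  refine (h.comp_injective hinj).congr fun n => ?_
  have hn : ‖(⟨_, hmem n⟩ : L)‖ = ‖n‖ := by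
    change ‖fun i => (n i : ℝ)‖ = ‖n‖
    simp only [Pi.norm_def]
    congr 2
  rw [Function.comp_apply, hn]

theorem RapidDecay.summable {d : (ι → ℤ) → ℂ} (hd : RapidDecay d) (k : ℕ) :
    Summable fun n => ‖n‖ ^ k * ‖d n‖ := by
  obtain ⟨C, hC⟩ := hd (k + (Fintype.card ι + 1))
  refine Summable.of_norm_bounded_eventually
    ((summable_norm_inv_pow (ι := ι) (Nat.lt_succ_self _)).mul_left C) ?_
  refine (Set.finite_singleton (0 : ι → ℤ)).subset fun n hn => ?_
  by_contra h0
  refine hn ?_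
  have hpos : 0 < ‖n‖ := norm_pos_iff.2 h0
  have := hC n
  rw [Set.mem_ofPred_eq, norm_mul, norm_pow, norm_norm, norm_norm, inv_pow, ← div_eq_mul_inv,
    le_div_iff₀ (by positivity)]
  calc _ = ‖n‖ ^ (k + (Fintype.card ι + 1)) * ‖d n‖ := by rw [pow_add, Nat.succ_eq_add_one]; ring
    _ ≤ C := this

theorem norm_freq_le (b : Basis ι ℝ E) : ∃ C, 0 ≤ C ∧ ∀ n : ι → ℤ,
    ‖freq b fun i => (n i : ℝ)‖ ≤ C * ‖n‖ := by
  refine ⟨∑ i, ‖LinearMap.toContinuousLinearMap (b.coord i)‖, by positivity, fun n => ?_⟩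
  rw [Finset.sum_mul]
  refine (norm_sum_le _ _).trans (Finset.sum_le_sum fun i _ => ?_)
  rw [norm_smul, mul_comm]
  refine mul_le_mul_of_nonneg_left ?_ (norm_nonneg _)
  exact (Int.norm_eq_abs (n i)).symm.le.trans' (Real.norm_eq_abs _).le |>.trans (norm_le_pi_norm n i)

theorem norm_iteratedFDeriv_chi_le (n : ι → ℤ) (k : ℕ) (v : E) :
    ‖iteratedFDeriv ℝ k (chi b n) v‖
      ≤ (2 * Real.pi) ^ k * ‖freq b fun i => (n i : ℝ)‖ ^ k := by
  let e : ℝ → ℂ := fun t => Complex.exp (2 * Real.pi * Complex.I * t)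
  have he : ContDiff ℝ ∞ e := (contDiff_const.mul Complex.ofRealCLM.contDiff).cexp
  have hder : ∀ k, iteratedDeriv k e = fun t => (2 * Real.pi * Complex.I) ^ k * e t := by
    intro k
    induction k with
    | zero => simp
    | succ k ih =>
      rw [iteratedDeriv_succ, ih]
      funext t
      have h1 : HasDerivAt e (e t * (2 * Real.pi * Complex.I)) t := by
        have := ((Complex.ofRealCLM.hasDerivAt (x := t)).const_mul
          (2 * Real.pi * Complex.I)).cexp
        simpa using this
      rw [(h1.const_mul _).deriv]
      ring
  have hcomp : chi b n = e ∘ freq b fun i => (n i : ℝ) := rfl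
  rw [hcomp, ContinuousLinearMap.iteratedFDeriv_comp_right _ he v (i := k) (by exact_mod_cast le_top)]
  refine (ContinuousMultilinearMap.norm_compContinuousLinearMap_le _ _).trans ?_
  rw [norm_iteratedFDeriv_eq_norm_iteratedDeriv, hder, Finset.prod_const, Finset.card_univ,
    Fintype.card_fin]
  refine mul_le_mul_of_nonneg_right ?_ (by positivity)
  rw [norm_mul, norm_pow]
  have h1 : ‖(2 * Real.pi * Complex.I : ℂ)‖ = 2 * Real.pi := by
    simp [abs_of_pos Real.pi_pos]
  have h2 : ‖e (freq b (fun i => (n i : ℝ)) v)‖ = 1 := norm_chi (b := b) n v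
  rw [h1, h2, mul_one]

/-- The function with prescribed Fourier coefficients. -/
noncomputable def synth (b : Basis ι ℝ E) (d : (ι → ℤ) → ℂ) (v : E) : ℂ :=
  ∑' n, d n * chi b n v

theorem RapidDecay.contDiff_synth {d : (ι → ℤ) → ℂ} (hd : RapidDecay d) :
    ContDiff ℝ ∞ (synth b d) := by
  obtain ⟨C, hC0, hC⟩ := norm_freq_le b
  refine contDiff_tsum (N := ⊤) (v := fun k n => (2 * Real.pi * C) ^ k * (‖n‖ ^ k * ‖d n‖))
    (fun n => contDiff_const.mul (contDiff_chi n)) (fun k _ => (hd.summable k).mul_left _) ?_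
  intro k n v _
  have : (fun v => d n * chi b n v) = d n • chi b n := rfl
  rw [this, iteratedFDeriv_const_smul_apply
    ((contDiff_chi n).of_le (by exact_mod_cast le_top)).contDiffAt, norm_smul]
  calc _ ≤ ‖d n‖ * ((2 * Real.pi) ^ k * (C * ‖n‖) ^ k) := by
        refine mul_le_mul_of_nonneg_left ((norm_iteratedFDeriv_chi_le n k v).trans ?_)
          (norm_nonneg _)
        have := hC n
        gcongr
    _ = _ := by rw [mul_pow, mul_pow, mul_pow, mul_pow]; ring

theorem isPeriodic_synth (d : (ι → ℤ) → ℂ) : IsPeriodic b (synth b d) := fun l hl v => by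
  simp only [synth, isPeriodic_chi _ l hl v]

theorem coeff_chi [DecidableEq ι] (m n : ι → ℤ) :
    coeff b n (chi b m) = if m = n then 1 else 0 := by
  have h : ∀ v, chi b (-n) v * chi b m v = chi b (-(n - m)) v * 1 := fun v => by
    rw [← chi_add_freq, mul_one, neg_sub, neg_add_eq_sub]
  have h' : coeff b n (chi b m) = coeff b (n - m) (fun _ => 1) := by simp only [coeff, h]
  rw [h']
  split_ifs with hmn
  · rw [hmn, sub_self, coeff_zero, avg_const]
  · exact coeff_const _ (sub_ne_zero.2 (Ne.symm hmn))

theorem RapidDecay.coeff_synth {d : (ι → ℤ) → ℂ} (hd : RapidDecay d) (n : ι → ℤ) :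
    coeff b n (synth b d) = d n := by
  classical
  have hs : Summable fun m => ‖d m‖ := by simpa using hd.summable 0
  have hper : ∀ m, IsPeriodic b fun v => chi b (-n) v * (d m * chi b m v) := fun m =>
    (isPeriodic_chi _).mul fun l hl v => by simp only [isPeriodic_chi _ l hl v]
  have hcont : ∀ m, Continuous fun v => chi b (-n) v * (d m * chi b m v) := fun m =>
    (contDiff_chi _).continuous.mul (continuous_const.mul (contDiff_chi _).continuous)
  have hnorm : ∀ m v, ‖chi b (-n) v * (d m * chi b m v)‖ = ‖d m‖ := fun m v => by
    rw [norm_mul, norm_mul, norm_chi, norm_chi, one_mul, mul_one]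
  have h := hasSum_integral_of_summable_integral_norm (μ := (volume : Measure (UnitAddTorus ι)))
    (F := fun m t => chi b (-n) (lift b t) * (d m * chi b m (lift b t)))
    (fun m => (hper m).integrable (hcont m))
    (by simp only [hnorm, integral_const, volume_real_univ, one_smul]; exact hs)
  have hterm : ∀ m, ∫ t, chi b (-n) (lift b t) * (d m * chi b m (lift b t))
      = if m = n then d n else 0 := fun m => by
    have : coeff b n (fun v => d m * chi b m v) = if m = n then d n else 0 := by
      rw [coeff_const_mul, coeff_chi]
      split_ifs with hmn
      · rw [hmn, mul_one]
      · rw [mul_zero]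
    exact this
  simp only [hterm, tsum_mul_left] at h
  exact h.unique (hasSum_ite_eq n (d n))

end TorusFourier

/-! ### Dolbeault cohomology of a complex torus -/

namespace ComplexTorus

open TorusFourier Module

variable {g : ℕ}

theorem isZLattice (X : ComplexTorus g) :
    haveI := X.discrete
    IsZLattice ℝ X.lattice :=
  haveI := X.discrete
  ⟨X.span_top⟩

theorem exists_latticeBasis (X : ComplexTorus g) : Nonempty (Basis (Fin (2 * g)) ℤ X.lattice) := by
  have := X.discrete
  have := X.isZLattice
  have := ZLattice.module_finite ℝ X.lattice
  have := ZLattice.module_free ℝ X.lattice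
  have h : finrank ℤ X.lattice = 2 * g := by
    rw [ZLattice.rank ℝ X.lattice, ← finrank_mul_finrank ℝ ℂ (Fin g → ℂ), finrank_fin_fun,
      Complex.finrank_real_complex]
  exact ⟨finBasisOfFinrankEq ℤ X.lattice h⟩

/-- A `ℤ`-basis of the lattice of a complex torus. -/
noncomputable def latticeBasis (X : ComplexTorus g) : Basis (Fin (2 * g)) ℤ X.lattice :=
  X.exists_latticeBasis.some

/-- A basis of the lattice of a complex torus, as a real basis of the universal covering. -/
noncomputable def realBasis (X : ComplexTorus g) : Basis (Fin (2 * g)) ℝ (Fin g → ℂ) :=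
  haveI := X.discrete
  haveI := X.isZLattice
  X.latticeBasis.ofZLatticeBasis ℝ X.lattice

theorem realBasis_apply (X : ComplexTorus g) (i : Fin (2 * g)) :
    X.realBasis i = X.latticeBasis i :=
  haveI := X.discrete
  haveI := X.isZLattice
  Basis.ofZLatticeBasis_apply ℝ X.lattice _ i

theorem span_realBasis (X : ComplexTorus g) :
    Submodule.span ℤ (Set.range X.realBasis) = X.lattice :=
  haveI := X.discrete
  haveI := X.isZLattice
  Basis.ofZLatticeBasis_span ℝ X.lattice X.latticeBasis

theorem isPeriodic_smoothFun (X : ComplexTorus g) (u : X.SmoothFun) :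
    IsPeriodic X.realBasis u.1 := by
  intro l hl
  rw [span_realBasis] at hl
  exact u.2.2 l hl

/-- The symbol of `∂/∂z̄_j`: the factor by which this operator multiplies the `n`-th Fourier
coefficient. It is defined for real `n`, to make its linearity available. -/
noncomputable def symbol (X : ComplexTorus g) (j : Fin g) (n : Fin (2 * g) → ℝ) : ℂ :=
  Real.pi * Complex.I * (freq X.realBasis n (Pi.single j 1)
    + Complex.I * freq X.realBasis n (Pi.single j Complex.I))

theorem coeff_dzbar (X : ComplexTorus g) (u : X.SmoothFun) (j : Fin g) (n : Fin (2 * g) → ℤ) :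
    coeff X.realBasis n (X.dzbar j u).1 = X.symbol j (fun i => n i) * coeff X.realBasis n u.1 := by
  have hu := X.isPeriodic_smoothFun u
  have h1 : ContDiff ℝ 1 u.1 := u.2.1.of_le (by simp)
  have hc : ∀ a, Continuous fun v => fderiv ℝ u.1 v a := fun a =>
    (h1.continuous_fderiv (by simp)).clm_apply continuous_const
  have h : (X.dzbar j u).1 = fun v => 2⁻¹ * (fderiv ℝ u.1 v (Pi.single j 1)
      + Complex.I * fderiv ℝ u.1 v (Pi.single j Complex.I)) := by
    funext v
    change wirtingerBar j u.1 v = _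
    rw [wirtingerBar, div_eq_inv_mul]
  rw [h, coeff_const_mul, coeff_add (w := fun v => Complex.I *
      fderiv ℝ u.1 v (Pi.single j Complex.I)) (hu.fderiv _) (hc _)
    (fun l hl v => congrArg _ (hu.fderiv _ l hl v)) (continuous_const.mul (hc _)),
    coeff_const_mul, coeff_fderiv hu h1, coeff_fderiv hu h1, symbol]
  ring

/-- Real linear forms are determined by their values on the real basis `e_j`, `i e_j` of `ℂ^g`;
hence the symbols of the operators `∂/∂z̄_j` have no common zero, and can be bounded below. -/
theorem exists_symbol_bound (X : ComplexTorus g) : ∃ c > 0, ∀ n : Fin (2 * g) → ℝ,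
    c * ‖n‖ ≤ ‖fun j => X.symbol j n‖ := by
  let S : (Fin (2 * g) → ℝ) →ₗ[ℝ] (Fin g → ℂ) :=
    { toFun := fun n j => X.symbol j n
      map_add' := fun n n' => by
        funext j
        simp only [symbol, freq_apply, Pi.add_apply, add_mul, Finset.sum_add_distrib]
        push_cast
        ring
      map_smul' := fun c n => by
        funext j
        simp only [symbol, freq_apply, Pi.smul_apply, smul_eq_mul, mul_assoc, ← Finset.mul_sum,
          RingHom.id_apply, Complex.real_smul]
        push_cast
        ring }
  have hinj : LinearMap.ker S = ⊥ := by
    rw [LinearMap.ker_eq_bot']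
    intro n hn
    have hj : ∀ j, freq X.realBasis n (Pi.single j 1) = 0 ∧
        freq X.realBasis n (Pi.single j Complex.I) = 0 := fun j => by
      have h0 : X.symbol j n = 0 := congrFun hn j
      have h1 : (Real.pi * Complex.I : ℂ) ≠ 0 :=
        mul_ne_zero (by exact_mod_cast Real.pi_ne_zero) Complex.I_ne_zero
      have h2 := (mul_eq_zero.1 h0).resolve_left h1
      have hre := congrArg Complex.re h2
      have him := congrArg Complex.im h2
      simp at hre him
      exact ⟨hre, him⟩
    have hz : ∀ v, freq X.realBasis n v = 0 := fun v => by
      have hv : v = ∑ j, ((v j).re • (Pi.single j 1 : Fin g → ℂ)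
          + (v j).im • (Pi.single j Complex.I : Fin g → ℂ)) := by
        funext i
        simp only [Finset.sum_apply, Pi.add_apply, Pi.smul_apply, Pi.single_apply, smul_ite,
          smul_zero, Finset.sum_add_distrib, Finset.sum_ite_eq, Finset.mem_univ, if_true,
          Complex.real_smul, mul_one]
        exact (Complex.re_add_im _).symm
      rw [hv]
      simp [map_sum, hj]
    funext i
    rw [← freq_basis (b := X.realBasis) n i, hz]
    rfl
  obtain ⟨K, hK, hanti⟩ := S.exists_antilipschitzWith hinj
  refine ⟨(K : ℝ)⁻¹, by positivity, fun n => ?_⟩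
  have h := hanti.le_mul_dist n 0
  rw [map_zero, dist_zero_right, dist_zero_right] at h
  rw [inv_mul_le_iff₀ (by positivity)]
  exact h

/-- A `∂̄`-closed `(0,1)`-form on a complex torus is cohomologous to a form with constant
coefficients: the equation `∂̄ u = β - c` is solved by division of the Fourier coefficients by the
symbols. -/
theorem exists_eq_const_add_dzbar (X : ComplexTorus g) (β : Fin g → X.SmoothFun)
    (hβ : ∀ j k, X.dzbar k (β j) = X.dzbar j (β k)) :
    ∃ (u : X.SmoothFun) (c : Fin g → ℂ), ∀ j v, (β j).1 v = c j + (X.dzbar j u).1 v := by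
  obtain ⟨c, hc, hbound⟩ := X.exists_symbol_bound
  have hper := fun j => X.isPeriodic_smoothFun (β j)
  have hmax : ∀ n : Fin (2 * g) → ℤ, n ≠ 0 →
      ∃ j, c ≤ ‖X.symbol j fun i => n i‖ := by
    intro n hn
    by_contra! hlt
    have h1 : 1 ≤ ‖fun i => (n i : ℝ)‖ := by
      obtain ⟨i, hi⟩ := Function.ne_iff.1 hn
      refine le_trans ?_ (norm_le_pi_norm _ i)
      rw [Real.norm_eq_abs]
      exact_mod_cast Int.one_le_abs hi
    have h2 := (pi_norm_lt_iff hc).2 hlt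
    nlinarith [hbound fun i => (n i : ℝ)]
  classical
  -- by closedness, the quotient does not depend on the choice of an index with a large symbol
  let d : (Fin (2 * g) → ℤ) → ℂ := fun n =>
    if hn : n ≠ 0 then coeff X.realBasis n (β (hmax n hn).choose).1
      / X.symbol (hmax n hn).choose (fun i => n i) else 0
  have hd : RapidDecay d := by
    intro k
    choose C hC using fun j => rapidDecay_coeff (hper j) (β j).2.1 k
    have hC0 : ∀ j, 0 ≤ C j := fun j => le_trans (by positivity) (hC j 0)
    refine ⟨(∑ j, C j) / c, fun n => ?_⟩
    by_cases hn : n ≠ 0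
    · simp only [d, dif_pos hn]
      rw [norm_div, ← mul_div_assoc]
      refine div_le_div₀ (Finset.sum_nonneg fun j _ => hC0 j) ?_ hc (hmax n hn).choose_spec
      exact (hC _ n).trans (Finset.single_le_sum (fun j _ => hC0 j) (Finset.mem_univ _))
    · simp only [d, dif_neg hn, norm_zero, mul_zero]
      exact div_nonneg (Finset.sum_nonneg fun j _ => hC0 j) hc.le
  let u : X.SmoothFun := ⟨synth X.realBasis d, hd.contDiff_synth, fun l hl =>
    isPeriodic_synth d l (by rwa [span_realBasis])⟩
  have hcoeff : ∀ n j, n ≠ 0 →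
      coeff X.realBasis n (X.dzbar j u).1 = coeff X.realBasis n (β j).1 := by
    intro n j hn
    have hne : X.symbol (hmax n hn).choose (fun i => n i) ≠ 0 :=
      norm_pos_iff.1 (hc.trans_le (hmax n hn).choose_spec)
    rw [coeff_dzbar, show coeff X.realBasis n u.1 = d n from hd.coeff_synth n]
    simp only [d, dif_pos hn]
    have h := congrArg (fun w : X.SmoothFun => coeff X.realBasis n w.1)
      (hβ j (hmax n hn).choose)
    simp only [coeff_dzbar] at h
    field_simp
    linear_combination -h
  refine ⟨u, fun j => avg X.realBasis (β j).1, fun j v => ?_⟩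
  set a := avg X.realBasis (β j).1 with ha
  have hperu := X.isPeriodic_smoothFun (X.dzbar j u)
  have hcu : Continuous (X.dzbar j u).1 := (X.dzbar j u).2.1.continuous
  have hcβ : Continuous (β j).1 := (β j).2.1.continuous
  have hzero := eq_zero_of_coeff_eq_zero (b := X.realBasis)
    (u := fun v => (β j).1 v + (-a + (-1) * (X.dzbar j u).1 v))
    (fun l hl v => by simp only [hper j l hl, hperu l hl])
    (hcβ.add (continuous_const.add (continuous_const.mul hcu))) (fun n => by
      rw [coeff_add (w := fun v => -a + (-1) * (X.dzbar j u).1 v) (hper j) hcβ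
        (fun l hl v => by simp only [hperu l hl])
        (continuous_const.add (continuous_const.mul hcu)),
        coeff_add (u := fun _ => -a) (w := fun v => (-1) * (X.dzbar j u).1 v)
        (fun _ _ _ => rfl) continuous_const
        (fun l hl v => by simp only [hperu l hl]) (continuous_const.mul hcu), coeff_const_mul]
      by_cases hn : n = 0
      · subst hn
        have hs : X.symbol j (fun i => (((0 : Fin (2 * g) → ℤ) i : ℤ) : ℝ)) = 0 := by
          simp [symbol, freq_apply]
        rw [coeff_dzbar, hs, coeff_zero, coeff_zero, avg_const, ← ha]
        ring
      · rw [hcoeff n j hn, coeff_const _ hn]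
        ring) v
  linear_combination hzero

theorem avg_dzbar (X : ComplexTorus g) (u : X.SmoothFun) (j : Fin g) :
    avg X.realBasis (X.dzbar j u).1 = 0 := by
  have hs : X.symbol j (fun i => (((0 : Fin (2 * g) → ℤ) i : ℤ) : ℝ)) = 0 := by
    simp [symbol, freq_apply]
  rw [← coeff_zero, coeff_dzbar, hs, zero_mul]

/-- The constant function with value `c`. -/
noncomputable def constFun (X : ComplexTorus g) : ℂ →ₗ[ℂ] X.SmoothFun where
  toFun c := Subtype.mk (fun _ => c) ⟨contDiff_const, fun _ _ _ => rfl⟩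
  map_add' _ _ := rfl
  map_smul' _ _ := rfl

theorem dzbar_constFun (X : ComplexTorus g) (j : Fin g) (c : ℂ) : X.dzbar j (X.constFun c) = 0 := by
  refine SmoothFun.ext fun v => ?_
  change wirtingerBar j (fun _ => c) v = 0
  simp [wirtingerBar]

/-- The `(1,1)`-form with constant coefficients `M i j`. -/
noncomputable def constForm (X : ComplexTorus g) : (Fin g → Fin g → ℂ) →ₗ[ℂ] X.Form11 where
  toFun M := fun i j => X.constFun (M i j)
  map_add' M M' := by
    funext i j
    simp only [Pi.add_apply, map_add]
  map_smul' c M := by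
    funext i j
    simp only [Pi.smul_apply, map_smul, RingHom.id_apply]

theorem constForm_mem_ker (X : ComplexTorus g) (M : Fin g → Fin g → ℂ) :
    X.constForm M ∈ LinearMap.ker X.dbar11 := by
  rw [LinearMap.mem_ker]
  funext i j k
  simp only [dbar11, constForm, LinearMap.coe_mk, AddHom.coe_mk, dzbar_constFun, sub_zero]
  rfl

/-- The cohomology class of a `(1,1)`-form with constant coefficients. -/
noncomputable def constClass (X : ComplexTorus g) : (Fin g → Fin g → ℂ) →ₗ[ℂ] X.H11 :=
  (Submodule.mkQ _).comp (X.constForm.codRestrict _ X.constForm_mem_ker)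

theorem constClass_injective (X : ComplexTorus g) : Function.Injective X.constClass := by
  rw [injective_iff_map_eq_zero]
  intro M hM
  obtain ⟨η, hη⟩ := (Submodule.Quotient.mk_eq_zero _).1 hM
  funext i j
  have h : - X.dzbar j (η i) = X.constFun (M i j) := congrFun (congrFun hη i) j
  have h2 := X.avg_dzbar (-η i) j
  rw [map_neg, h] at h2
  exact (avg_const (b := X.realBasis) (M i j)).symm.trans h2

theorem constClass_surjective (X : ComplexTorus g) : Function.Surjective X.constClass := by
  intro x
  obtain ⟨⟨ψ, hψ⟩, rfl⟩ := Submodule.Quotient.mk_surjective _ x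
  have hclosed : ∀ i j k, X.dzbar k (ψ i j) = X.dzbar j (ψ i k) := fun i j k =>
    sub_eq_zero.1 (congrFun (congrFun (congrFun (LinearMap.mem_ker.1 hψ) i) j) k)
  choose u c huc using fun i => X.exists_eq_const_add_dzbar (ψ i) (hclosed i)
  refine ⟨c, (Submodule.Quotient.eq _).2 ⟨u, ?_⟩⟩
  funext i j
  refine SmoothFun.ext fun v => ?_
  have h1 : (X.dbar10 u i j).1 v = -(X.dzbar j (u i)).1 v := rfl
  have h2 : (((X.constForm.codRestrict _ X.constForm_mem_ker c - ⟨ψ, hψ⟩ :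
    LinearMap.ker X.dbar11) : X.Form11) i j).1 v = c i j - (ψ i j).1 v := rfl
  rw [h1]
  refine Eq.trans ?_ h2.symm
  rw [huc i j v]
  ring

/-- On a complex torus, `H^{1,1}` is the space of `(1,1)`-forms with constant coefficients. -/
noncomputable def constClassEquiv (X : ComplexTorus g) : (Fin g → Fin g → ℂ) ≃ₗ[ℂ] X.H11 :=
  LinearEquiv.ofBijective X.constClass ⟨X.constClass_injective, X.constClass_surjective⟩

theorem pullH11_constClass (X : ComplexTorus g) (f : X.endo) (M : Fin g → Fin g → ℂ) :
    pullH11 f (X.constClass M) = X.constClass fun k l =>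
      ∑ i, ∑ j, analyticRep f i k * star (analyticRep f j l) * M i j := by
  change Submodule.Quotient.mk _ = Submodule.Quotient.mk _
  congr 1
  refine Subtype.ext ?_
  funext k l
  change ∑ i, ∑ j, (analyticRep f i k * star (analyticRep f j l)) •
    pullFun f (X.constFun (M i j)) = X.constFun _
  simp only [map_sum]
  refine Finset.sum_congr rfl fun i _ => Finset.sum_congr rfl fun j _ => ?_
  rw [← smul_eq_mul (a := _ * star _), map_smul]
  rfl

end ComplexTorus

/-! ### Growth of powers of matrices -/

section Growth

open Filter

attribute [local instance] Matrix.linftyOpNormedRing Matrix.linftyOpNormedAlgebra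

/-- Any norm on a finite-dimensional real vector space is equivalent to the given one. -/
theorem Seminorm.exists_norm_bounds {V : Type*} [NormedAddCommGroup V] [NormedSpace ℝ V]
    [FiniteDimensional ℝ V] (p : Seminorm ℝ V) (hp : ∀ x, p x = 0 → x = 0) :
    ∃ c > 0, ∃ C > 0, ∀ x, c * ‖x‖ ≤ p x ∧ p x ≤ C * ‖x‖ := by
  have hcont : Continuous p := continuousOn_univ.1 (p.convexOn.continuousOn isOpen_univ)
  have : ProperSpace V := FiniteDimensional.proper ℝ V
  have hscale : ∀ x : V, x ≠ 0 → p x = ‖x‖ * p (‖x‖⁻¹ • x) := fun x hx => by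
    rw [map_smul_eq_mul, norm_inv, norm_norm, ← mul_assoc, mul_inv_cancel₀ (norm_ne_zero_iff.2 hx),
      one_mul]
  have hsph : ∀ x : V, x ≠ 0 → ‖x‖⁻¹ • x ∈ Metric.sphere (0 : V) 1 := fun x hx => by
    rw [mem_sphere_zero_iff_norm, norm_smul, norm_inv, norm_norm,
      inv_mul_cancel₀ (norm_ne_zero_iff.2 hx)]
  rcases subsingleton_or_nontrivial V with hV | hV
  · exact ⟨1, one_pos, 1, one_pos, fun x => by rw [Subsingleton.elim x 0]; simp⟩
  have hne : (Metric.sphere (0 : V) 1).Nonempty := NormedSpace.sphere_nonempty.2 zero_le_one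
  obtain ⟨x₀, hx₀, hmin⟩ := (isCompact_sphere (0 : V) 1).exists_isMinOn hne hcont.continuousOn
  obtain ⟨x₁, hx₁, hmax⟩ := (isCompact_sphere (0 : V) 1).exists_isMaxOn hne hcont.continuousOn
  have hpos : ∀ x ∈ Metric.sphere (0 : V) 1, 0 < p x := fun x hx =>
    lt_of_le_of_ne (apply_nonneg p x) fun h0 => by
      have := hp x h0.symm
      rw [this] at hx
      simp at hx
  refine ⟨p x₀, hpos x₀ hx₀, p x₁, hpos x₁ hx₁, fun x => ?_⟩
  by_cases hx : x = 0
  · simp [hx]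
  · rw [hscale x hx, mul_comm _ ‖x‖, mul_comm _ ‖x‖]
    exact ⟨mul_le_mul_of_nonneg_left (hmin (hsph x hx)) (norm_nonneg _),
      mul_le_mul_of_nonneg_left (hmax (hsph x hx)) (norm_nonneg _)⟩

namespace Matrix

variable {n : Type*} [Fintype n] [DecidableEq n]

/-- The spectral radius of a complex matrix, as a real number. -/
noncomputable def specRad (A : Matrix n n ℂ) : ℝ := (spectralRadius ℂ A).toReal

theorem spectralRadius_ne_top (A : Matrix n n ℂ) : spectralRadius ℂ A ≠ ⊤ := by
  refine ne_top_of_le_ne_top (b := ((‖A‖₊ * ‖(1 : Matrix n n ℂ)‖₊ : NNReal) : ENNReal))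
    ENNReal.coe_ne_top (iSup₂_le fun z hz => ?_)
  exact_mod_cast spectrum.norm_le_norm_mul_of_mem hz

theorem norm_le_specRad {A : Matrix n n ℂ} {z : ℂ} (hz : z ∈ spectrum ℂ A) : ‖z‖ ≤ A.specRad := by
  have h : (‖z‖₊ : ENNReal) ≤ spectralRadius ℂ A := le_iSup₂ (f := fun k _ => (‖k‖₊ : ENNReal)) z hz
  exact ENNReal.toReal_mono A.spectralRadius_ne_top h

theorem tendsto_norm_pow_rpow (A : Matrix n n ℂ) :
    Tendsto (fun k : ℕ => ‖A ^ k‖ ^ (1 / k : ℝ)) atTop (𝓝 A.specRad) := by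
  have h := spectrum.pow_norm_pow_one_div_tendsto_nhds_spectralRadius A
  have h2 := (ENNReal.tendsto_toReal A.spectralRadius_ne_top).comp h
  refine h2.congr fun k => ?_
  rw [Function.comp_apply, ENNReal.toReal_ofReal (by positivity)]

/-- A sequence which grows like `‖A ^ k‖ ^ e` has exponential growth rate the `e`-th power of the
spectral radius. -/
theorem tendsto_rpow_of_bounds (A : Matrix n n ℂ) (e : ℕ) {c C : ℝ} (hc : 0 < c) (hC : 0 < C)
    {x : ℕ → ℝ} (hx : ∀ k, c * ‖A ^ k‖ ^ e ≤ x k ∧ x k ≤ C * ‖A ^ k‖ ^ e) :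
    Tendsto (fun k : ℕ => x k ^ (1 / k : ℝ)) atTop (𝓝 (A.specRad ^ e)) := by
  have hlim : ∀ a : ℝ, 0 < a → Tendsto (fun k : ℕ => (a * ‖A ^ k‖ ^ e) ^ (1 / k : ℝ)) atTop
      (𝓝 (A.specRad ^ e)) := by
    intro a ha
    have h1 : Tendsto (fun k : ℕ => a ^ (1 / k : ℝ)) atTop (𝓝 1) := by
      have := (tendsto_const_nhds (x := a)).rpow (tendsto_one_div_atTop_nhds_zero_nat (𝕜 := ℝ))
        (Or.inl ha.ne')
      simpa using this
    have h2 := h1.mul (A.tendsto_norm_pow_rpow.pow e)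
    rw [one_mul] at h2
    refine h2.congr fun k => ?_
    rw [Real.mul_rpow ha.le (by positivity), ← Real.rpow_natCast, ← Real.rpow_natCast,
      ← Real.rpow_mul (norm_nonneg _), ← Real.rpow_mul (norm_nonneg _), mul_comm (e : ℝ)]
  refine tendsto_of_tendsto_of_tendsto_of_le_of_le (hlim c hc) (hlim C hC) (fun k => ?_)
    (fun k => ?_)
  · exact Real.rpow_le_rpow (by positivity) (hx k).1 (by positivity)
  · exact Real.rpow_le_rpow ((by positivity : 0 ≤ c * ‖A ^ k‖ ^ e).trans (hx k).1) (hx k).2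
      (by positivity)

/-- A faithful real linear representation of a matrix ring which respects the powers of `A`
preserves the spectral radius of `A`. -/
theorem specRad_eq_of_linearMap {m : Type*} [Fintype m] [DecidableEq m]
    (φ : Matrix n n ℂ →ₗ[ℝ] Matrix m m ℂ) (hφ : Function.Injective φ) (A : Matrix n n ℂ)
    (hpow : ∀ k : ℕ, φ (A ^ k) = φ A ^ k) : (φ A).specRad = A.specRad := by
  obtain ⟨c, hc, C, hC, h⟩ := Seminorm.exists_norm_bounds
    ((normSeminorm ℝ (Matrix m m ℂ)).comp φ) fun x hx => by
      have : φ x = 0 := norm_eq_zero.1 hx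
      exact hφ (this.trans (map_zero φ).symm)
  have h1 := A.tendsto_rpow_of_bounds 1 hc hC (x := fun k => ‖φ A ^ k‖) fun k => by
    rw [pow_one, ← hpow]
    exact h (A ^ k)
  rw [pow_one] at h1
  exact tendsto_nhds_unique (φ A).tendsto_norm_pow_rpow h1

theorem exists_entry_norm_bounds (n : Type*) [Fintype n] [DecidableEq n] :
    ∃ c > 0, ∃ C > 0, ∀ A : Matrix n n ℂ,
      c * ‖A‖ ≤ ‖(fun i j => A i j : n → n → ℂ)‖ ∧ ‖(fun i j => A i j : n → n → ℂ)‖ ≤ C * ‖A‖ := by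
  let L : Matrix n n ℂ →ₗ[ℝ] (n → n → ℂ) :=
    { toFun := fun A i j => A i j
      map_add' := fun _ _ => rfl
      map_smul' := fun _ _ => rfl }
  exact Seminorm.exists_norm_bounds ((normSeminorm ℝ (n → n → ℂ)).comp L) fun A hA => by
    have : L A = 0 := norm_eq_zero.1 hA
    ext i j
    exact congrFun (congrFun this i) j

/-- The spectral radius only depends on the characteristic polynomial. -/
theorem specRad_eq_iSup (A : Matrix n n ℂ) :
    A.specRad = (⨆ z ∈ {z | A.charpoly.IsRoot z}, (‖z‖₊ : ENNReal)).toReal := by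
  have : spectrum ℂ A = {z | A.charpoly.IsRoot z} := by
    ext z
    exact Matrix.mem_spectrum_iff_isRoot_charpoly
  rw [specRad, spectralRadius, this]

end Matrix

theorem Polynomial.finite_setOf_coeff_le (m : ℕ) (B : ℝ) :
    {p : Polynomial ℤ | p.natDegree ≤ m ∧ ∀ i, |(p.coeff i : ℝ)| ≤ B}.Finite := by
  let F : Polynomial ℤ → (Fin (m + 1) → ℤ) := fun p i => p.coeff i
  refine Set.Finite.of_finite_image (f := F) ?_ ?_
  · refine (Set.Finite.pi' fun _ : Fin (m + 1) => Set.finite_Icc (-⌊B⌋) ⌊B⌋).subset ?_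
    rintro _ ⟨p, ⟨-, hp⟩, rfl⟩ i
    have h := abs_le.1 (hp i)
    refine ⟨?_, Int.le_floor.2 h.2⟩
    rw [neg_le]
    exact Int.le_floor.2 (by push_cast; linarith)
  · rintro p ⟨hp, -⟩ q ⟨hq, -⟩ hpq
    ext i
    by_cases hi : i < m + 1
    · exact congrFun hpq ⟨i, hi⟩
    · rw [Polynomial.coeff_eq_zero_of_natDegree_lt (by omega),
        Polynomial.coeff_eq_zero_of_natDegree_lt (by omega)]

/-- The spectral radii of integer matrices of a given size form a discrete set: characteristic
polynomials with bounded roots have bounded integer coefficients. -/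
theorem Matrix.finite_specRad_le (m : ℕ) (B : ℝ) :
    {r : ℝ | r ≤ B ∧ ∃ R : Matrix (Fin m) (Fin m) ℤ,
      r = (R.map (Int.cast : ℤ → ℂ)).specRad}.Finite := by
  refine ((Polynomial.finite_setOf_coeff_le m (max B 1 ^ m * m.choose (m / 2))).image
    fun p : Polynomial ℤ =>
      (⨆ z ∈ {z | (p.map (Int.castRingHom ℂ)).IsRoot z}, (‖z‖₊ : ENNReal)).toReal).subset ?_
  rintro _ ⟨hB, R, rfl⟩
  have hchar : (R.map (Int.cast : ℤ → ℂ)).charpoly = R.charpoly.map (Int.castRingHom ℂ) :=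
    Matrix.charpoly_map R (Int.castRingHom ℂ)
  have hdeg : R.charpoly.natDegree = m := by
    rw [Matrix.charpoly_natDegree_eq_dim, Fintype.card_fin]
  refine ⟨R.charpoly, ⟨hdeg.le, fun i => ?_⟩, ?_⟩
  · have h := Polynomial.coeff_bdd_of_roots_le (B := B) (Int.castRingHom ℂ) R.charpoly_monic
      (IsAlgClosed.splits _) hdeg.le (fun z hz => ?_) i
    · simpa using h
    · refine le_trans (norm_le_specRad ?_) hB
      rw [Matrix.mem_spectrum_iff_isRoot_charpoly, hchar]
      exact Polynomial.isRoot_of_mem_roots hz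
  · rw [specRad_eq_iSup, hchar]

end Growth

/-! ### The first dynamical degree is the square of a spectral radius -/

namespace ComplexTorus

open Module

variable {g : ℕ}

theorem exists_norm_lt_imp_eq_zero (X : ComplexTorus g) :
    ∃ e > 0, ∀ x ∈ X.lattice, ‖x‖ < e → x = 0 := by
  have := X.discrete
  obtain ⟨e, he, hs⟩ := Metric.exists_ball_inter_eq_singleton_of_mem_discrete
    (s := (X.lattice : Set (Fin g → ℂ))) (isDiscrete_iff_discreteTopology.2 this)
    X.lattice.zero_mem
  refine ⟨e, he, fun x hx hxe => ?_⟩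
  have : x ∈ Metric.ball (0 : Fin g → ℂ) e ∩ (X.lattice : Set (Fin g → ℂ)) :=
    ⟨by simpa using hxe, hx⟩
  rw [hs] at this
  exact this

/-- A lattice contains no complex line. -/
theorem eq_zero_of_smul_mem (X : ComplexTorus g) {w : Fin g → ℂ}
    (h : ∀ t : ℂ, t • w ∈ X.lattice) : w = 0 := by
  obtain ⟨e, he, hX⟩ := X.exists_norm_lt_imp_eq_zero
  by_contra hw
  have hpos : 0 < ‖w‖ := norm_pos_iff.2 hw
  have ht : ((e / (2 * ‖w‖) : ℝ) : ℂ) ≠ 0 := by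
    exact_mod_cast (by positivity : (0 : ℝ) < e / (2 * ‖w‖)).ne'
  refine hw ((smul_eq_zero.1 (hX _ (h _) ?_)).resolve_left ht)
  rw [norm_smul, Complex.norm_real, Real.norm_eq_abs, abs_of_pos (by positivity)]
  field_simp
  linarith

theorem analyticRep_eq {X : ComplexTorus g} (f : X.endo) {B : Matrix (Fin g) (Fin g) ℂ}
    (hB : ∀ v, f.1 (X.proj v) = X.proj (B.mulVec v)) : analyticRep f = B := by
  have h : ∀ v, (analyticRep f - B).mulVec v = 0 := fun v =>
    X.eq_zero_of_smul_mem fun t => by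
      rw [← Matrix.mulVec_smul, Matrix.sub_mulVec, ← proj_eq_iff, ← analyticRep_spec, hB]
  rw [← sub_eq_zero]
  exact Matrix.ext_of_mulVec_single fun i => by rw [h, Matrix.zero_mulVec]

theorem analyticRep_one (X : ComplexTorus g) : analyticRep (1 : X.endo) = 1 :=
  analyticRep_eq _ fun v => by rw [Matrix.one_mulVec]; rfl

theorem analyticRep_mul {X : ComplexTorus g} (f f' : X.endo) :
    analyticRep (f * f') = analyticRep f * analyticRep f' :=
  analyticRep_eq _ fun v => by
    rw [← Matrix.mulVec_mulVec, ← analyticRep_spec, ← analyticRep_spec]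
    rfl

theorem analyticRep_pow {X : ComplexTorus g} (f : X.endo) (k : ℕ) :
    analyticRep (f ^ k) = analyticRep f ^ k := by
  induction k with
  | zero => rw [pow_zero, pow_zero, analyticRep_one]
  | succ k ih => rw [pow_succ, pow_succ, analyticRep_mul, ih]

/-- The endomorphism of the space of `g × g` matrices with entries `τ i j k l`. -/
noncomputable def tensorMap (g : ℕ) :
    (Fin g → Fin g → Fin g → Fin g → ℂ) →ₗ[ℂ] Module.End ℂ (Fin g → Fin g → ℂ) where
  toFun τ :=
    { toFun := fun M k l => ∑ i, ∑ j, τ i j k l * M i j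
      map_add' := fun M M' => by
        funext k l
        simp only [Pi.add_apply, mul_add, Finset.sum_add_distrib]
      map_smul' := fun c M => by
        funext k l
        simp only [Pi.smul_apply, smul_eq_mul, RingHom.id_apply, Finset.mul_sum,
          mul_left_comm _ c] }
  map_add' τ τ' := by
    refine LinearMap.ext fun M => ?_
    funext k l
    simp only [LinearMap.coe_mk, AddHom.coe_mk, LinearMap.add_apply, Pi.add_apply, add_mul,
      Finset.sum_add_distrib]
  map_smul' c τ := by
    refine LinearMap.ext fun M => ?_
    funext k l
    simp only [LinearMap.coe_mk, AddHom.coe_mk, LinearMap.smul_apply, Pi.smul_apply,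
      smul_eq_mul, Finset.mul_sum, mul_assoc, RingHom.id_apply]

/-- The endomorphism of `H^{1,1}` whose matrix, in the basis given by the classes of the forms
`dz_i ∧ dz̄_j`, has the entries `τ i j k l`. -/
noncomputable def tensorEnd (X : ComplexTorus g) :
    (Fin g → Fin g → Fin g → Fin g → ℂ) →ₗ[ℂ] Module.End ℂ X.H11 :=
  X.constClassEquiv.conj.toLinearMap.comp (tensorMap g)

theorem tensorEnd_injective (X : ComplexTorus g) : Function.Injective X.tensorEnd := by
  rw [injective_iff_map_eq_zero]
  intro τ hτ
  have h : tensorMap g τ = 0 := X.constClassEquiv.conj.map_eq_zero_iff.1 hτ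
  funext i j k l
  have h2 := congrFun (congrFun (LinearMap.congr_fun h (Pi.single i (Pi.single j 1))) k) l
  simp only [tensorMap, LinearMap.coe_mk, AddHom.coe_mk] at h2
  rw [Finset.sum_eq_single i, Finset.sum_eq_single j] at h2
  · simpa using h2
  · intro b _ hb
    simp [hb]
  · simp
  · intro b _ hb
    simp [hb]
  · simp

theorem pullH11_eq_tensorEnd (X : ComplexTorus g) (f : X.endo) :
    pullH11 f = X.tensorEnd fun i j k l => analyticRep f i k * star (analyticRep f j l) := by
  refine LinearMap.ext fun x => ?_
  obtain ⟨M, rfl⟩ := X.constClassEquiv.surjective x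
  refine (X.pullH11_constClass f M).trans ?_
  refine Eq.trans ?_ (LinearEquiv.conj_apply_apply X.constClassEquiv _ _).symm
  rw [LinearEquiv.symm_apply_apply]
  rfl

attribute [local instance] Matrix.linftyOpNormedRing Matrix.linftyOpNormedAlgebra

theorem norm_tensor (A : Matrix (Fin g) (Fin g) ℂ) :
    ‖(fun i j k l => A i k * star (A j l) : Fin g → Fin g → Fin g → Fin g → ℂ)‖
      = ‖(fun i j => A i j : Fin g → Fin g → ℂ)‖ ^ 2 := by
  set a := ‖(fun i j => A i j : Fin g → Fin g → ℂ)‖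
  set t := ‖(fun i j k l => A i k * star (A j l) : Fin g → Fin g → Fin g → Fin g → ℂ)‖
  have hle : ∀ i j, ‖A i j‖ ≤ a := fun i j =>
    (norm_le_pi_norm (A i) j).trans (norm_le_pi_norm (fun i j => A i j) i)
  refine le_antisymm ?_ ?_
  · simp only [t, pi_norm_le_iff_of_nonneg (sq_nonneg a), norm_mul, norm_star]
    intro i j k l
    rw [sq]
    exact mul_le_mul (hle i k) (hle j l) (norm_nonneg _) (norm_nonneg _)
  · have ht : ∀ i k, ‖A i k‖ ≤ Real.sqrt t := fun i k => by
      refine Real.le_sqrt_of_sq_le ?_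
      have h : ‖A i k * star (A i k)‖ ≤ t :=
        (norm_le_pi_norm (fun l => A i k * star (A i l)) k).trans <|
        (norm_le_pi_norm (fun k l => A i k * star (A i l)) k).trans <|
        (norm_le_pi_norm (fun j k l => A i k * star (A j l)) i).trans <|
        norm_le_pi_norm (fun i j k l => A i k * star (A j l)) i
      rwa [norm_mul, norm_star, ← sq] at h
    have ha : a ≤ Real.sqrt t := by
      simp only [a, pi_norm_le_iff_of_nonneg (Real.sqrt_nonneg t)]
      exact ht
    calc a ^ 2 ≤ Real.sqrt t ^ 2 := pow_le_pow_left₀ (norm_nonneg _) ha 2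
      _ = t := Real.sq_sqrt (norm_nonneg _)

/-- Every norm of `f^*` on `H^{1,1}` is comparable to the square of the norm of the analytic
representation of `f`, because the tensors `A i k * conj (A j l)` lie in a finite-dimensional space,
where all norms are equivalent. -/
theorem exists_norm_pullH11_bounds (X : ComplexTorus g) (N : Seminorm ℂ (Module.End ℂ X.H11))
    (hN : ∀ T, N T = 0 → T = 0) : ∃ c > 0, ∃ C > 0, ∀ f : X.endo,
      c * ‖analyticRep f‖ ^ 2 ≤ N (pullH11 f) ∧ N (pullH11 f) ≤ C * ‖analyticRep f‖ ^ 2 := by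
  obtain ⟨c, hc, C, hC, h⟩ := Seminorm.exists_norm_bounds
    ((N.comp X.tensorEnd).restrictScalars ℝ) fun τ hτ =>
      X.tensorEnd_injective ((hN _ hτ).trans (map_zero _).symm)
  obtain ⟨c', hc', C', hC', h'⟩ := Matrix.exists_entry_norm_bounds (Fin g)
  refine ⟨c * c' ^ 2, by positivity, C * C' ^ 2, by positivity, fun f => ?_⟩
  have h1 := h fun i j k l => analyticRep f i k * star (analyticRep f j l)
  have h2 := h' (analyticRep f)
  rw [norm_tensor] at h1
  rw [pullH11_eq_tensorEnd, mul_assoc, mul_assoc, ← mul_pow, ← mul_pow]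
  refine ⟨le_trans ?_ h1.1, h1.2.trans ?_⟩
  · exact mul_le_mul_of_nonneg_left (pow_le_pow_left₀ (by positivity) h2.1 2) hc.le
  · exact mul_le_mul_of_nonneg_left (pow_le_pow_left₀ (norm_nonneg _) h2.2 2) hC.le

theorem exists_norm_end (X : ComplexTorus g) :
    ∃ N : Seminorm ℂ (Module.End ℂ X.H11), ∀ T, N T = 0 → T = 0 := by
  have : Module.Finite ℂ X.H11 := Module.Finite.equiv X.constClassEquiv
  let e := (Module.finBasis ℂ (Module.End ℂ X.H11)).equivFun
  refine ⟨(normSeminorm ℂ _).comp e.toLinearMap, fun T hT => ?_⟩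
  have : e T = 0 := norm_eq_zero.1 hT
  exact e.map_eq_zero_iff.1 this

/-- The first dynamical degree of `f` is the square of the spectral radius of its analytic
representation, as `H^{1,1}` is the tensor product of the cotangent space and its conjugate. -/
theorem isFirstDynamicalDegree_iff {X : ComplexTorus g} (f : X.endo) (lam : ℝ) :
    IsFirstDynamicalDegree f lam ↔ lam = (analyticRep f).specRad ^ 2 := by
  have key : ∀ N : Seminorm ℂ (Module.End ℂ X.H11), (∀ T, N T = 0 → T = 0) →
      Filter.Tendsto (fun n : ℕ => N (pullH11 (f ^ n)) ^ (1 / (n : ℝ))) Filter.atTop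
        (𝓝 ((analyticRep f).specRad ^ 2)) := fun N hN => by
    obtain ⟨c, hc, C, hC, h⟩ := X.exists_norm_pullH11_bounds N hN
    refine (analyticRep f).tendsto_rpow_of_bounds 2 hc hC fun k => ?_
    rw [← analyticRep_pow]
    exact h (f ^ k)
  constructor
  · intro h
    obtain ⟨N, hN⟩ := X.exists_norm_end
    exact tendsto_nhds_unique (h N hN) (key N hN)
  · rintro rfl
    exact key

/-- The rational representation of a matrix: the matrix of the associated real linear map with
respect to a basis of the lattice. -/
noncomputable def rationalRep (X : ComplexTorus g) :
    Matrix (Fin g) (Fin g) ℂ →ₗ[ℝ] Matrix (Fin (2 * g)) (Fin (2 * g)) ℂ where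
  toFun A := (LinearMap.toMatrix X.realBasis X.realBasis
    ((Matrix.mulVecLin A).restrictScalars ℝ)).map Complex.ofReal
  map_add' A A' := by
    ext i j
    simp [LinearMap.toMatrix_apply]
  map_smul' c A := by
    ext i j
    simp [LinearMap.toMatrix_apply]

theorem rationalRep_injective (X : ComplexTorus g) : Function.Injective X.rationalRep := by
  intro A A' h
  have h1 := Matrix.map_injective Complex.ofReal_injective h
  have h2 := (LinearMap.toMatrix X.realBasis X.realBasis).injective h1
  refine Matrix.ext_of_mulVec_single fun i => ?_
  exact LinearMap.congr_fun h2 _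

theorem rationalRep_pow (X : ComplexTorus g) (A : Matrix (Fin g) (Fin g) ℂ) (k : ℕ) :
    X.rationalRep (A ^ k) = X.rationalRep A ^ k := by
  have hmul : ∀ A A', X.rationalRep (A * A') = X.rationalRep A * X.rationalRep A' := fun A A' => by
    simp only [rationalRep, LinearMap.coe_mk, AddHom.coe_mk]
    rw [Matrix.mulVecLin_mul, LinearMap.restrictScalars_comp,
      LinearMap.toMatrix_comp X.realBasis X.realBasis X.realBasis]
    exact Matrix.map_mul (f := Complex.ofRealHom)
  induction k with
  | zero =>
    rw [pow_zero, pow_zero]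
    simp only [rationalRep, LinearMap.coe_mk, AddHom.coe_mk, Matrix.mulVecLin_one]
    have : (LinearMap.id : (Fin g → ℂ) →ₗ[ℂ] (Fin g → ℂ)).restrictScalars ℝ = LinearMap.id := rfl
    rw [this, LinearMap.toMatrix_id]
    exact Matrix.map_one _ Complex.ofReal_zero Complex.ofReal_one
  | succ k ih => rw [pow_succ, pow_succ, hmul, ih]

theorem exists_rationalRep_eq {X : ComplexTorus g} {A : Matrix (Fin g) (Fin g) ℂ}
    (hA : ∀ l ∈ X.lattice, A.mulVec l ∈ X.lattice) :
    ∃ R : Matrix (Fin (2 * g)) (Fin (2 * g)) ℤ, X.rationalRep A = R.map (Int.cast : ℤ → ℂ) := by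
  have h : ∀ j i, ∃ k : ℤ, (k : ℝ) = X.realBasis.repr (A.mulVec (X.realBasis j)) i := fun j => by
    have := hA (X.realBasis j) (by rw [realBasis_apply]; exact (X.latticeBasis j).2)
    rw [← span_realBasis, X.realBasis.mem_span_iff_repr_mem ℤ] at this
    exact fun i => this i
  choose R hR using h
  refine ⟨Matrix.of fun i j => R j i, ?_⟩
  ext i j
  simp only [rationalRep, LinearMap.coe_mk, AddHom.coe_mk, Matrix.map_apply, Matrix.of_apply,
    LinearMap.toMatrix_apply, LinearMap.restrictScalars_apply, Matrix.mulVecLin_apply, ← hR]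
  simp

/-- The first dynamical degrees of the endomorphisms of `g`-dimensional complex tori form a
discrete set. -/
theorem finite_firstDynamicalDegree_le (g : ℕ) (B : ℝ) :
    {lam : ℝ | lam ≤ B ∧ ∃ (X : ComplexTorus g) (f : X.endo),
      IsFirstDynamicalDegree f lam}.Finite := by
  refine ((Matrix.finite_specRad_le (2 * g) (max B 1)).image fun r => r ^ 2).subset ?_
  rintro lam ⟨hB, X, f, hf⟩
  rw [isFirstDynamicalDegree_iff] at hf
  obtain ⟨R, hR⟩ := exists_rationalRep_eq (fun l hl => analyticRep_mem f hl)
  have h := Matrix.specRad_eq_of_linearMap X.rationalRep X.rationalRep_injective (analyticRep f)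
    (X.rationalRep_pow _)
  refine ⟨(analyticRep f).specRad, ⟨?_, R, by rw [← hR, h]⟩, hf.symm⟩
  by_contra! hlt
  have h1 := (le_max_right B 1).trans_lt hlt
  have h2 := (le_max_left B 1).trans_lt hlt
  nlinarith

/-- A nonempty set of first dynamical degrees has a minimum. -/
theorem exists_isLeast_of_firstDynamicalDegree {S : Set ℝ} (hne : S.Nonempty)
    (hS : ∀ lam ∈ S, ∃ (X : ComplexTorus g) (f : X.endo), IsFirstDynamicalDegree f lam) :
    ∃ a, IsLeast S a := by
  obtain ⟨B, hB⟩ := hne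
  have hfin : {lam | lam ∈ S ∧ lam ≤ B}.Finite :=
    (finite_firstDynamicalDegree_le g B).subset fun lam h => ⟨h.2, hS lam h.1⟩
  obtain ⟨a, ha, hmin⟩ := hfin.exists_minimal ⟨B, hB, le_rfl⟩
  refine ⟨a, ha.1, fun x hx => ?_⟩
  rcases le_total x B with h | h
  · rcases le_total a x with h' | h'
    · exact h'
    · exact hmin ⟨hx, h⟩ h'
  · exact ha.2.trans h

end ComplexTorus

/-! ### A unimodular integer matrix with irreducible, totally real characteristic polynomial -/

section CompanionMatrix

open Polynomial

/-- Pólya's polynomial `∏ (x - 4 i) - 1`, the product being over `0 ≤ i < g`. -/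
noncomputable def polyaPoly (g : ℕ) : ℤ[X] := ∏ i ∈ Finset.range g, (X - C (4 * (i : ℤ))) - 1

theorem natDegree_prod_polya (g : ℕ) :
    (∏ i ∈ Finset.range g, (X - C (4 * (i : ℤ)))).natDegree = g := by
  rw [natDegree_prod_of_monic _ _ fun i _ => monic_X_sub_C _]
  simp only [natDegree_X_sub_C, Finset.sum_const, Finset.card_range, smul_eq_mul, mul_one]

theorem monic_prod_polya (g : ℕ) : (∏ i ∈ Finset.range g, (X - C (4 * (i : ℤ)))).Monic :=
  monic_prod_of_monic _ _ fun _ _ => monic_X_sub_C _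

theorem degree_one_lt_prod_polya {g : ℕ} (hg : 0 < g) :
    (1 : ℤ[X]).degree < (∏ i ∈ Finset.range g, (X - C (4 * (i : ℤ)))).degree := by
  rw [degree_one, degree_eq_natDegree (monic_prod_polya g).ne_zero, natDegree_prod_polya]
  exact_mod_cast hg

theorem monic_polyaPoly {g : ℕ} (hg : 0 < g) : (polyaPoly g).Monic :=
  (monic_prod_polya g).sub_of_left (degree_one_lt_prod_polya hg)

theorem natDegree_polyaPoly {g : ℕ} (hg : 0 < g) : (polyaPoly g).natDegree = g := by
  rw [polyaPoly, natDegree_eq_of_degree_eq (degree_sub_eq_left_of_degree_lt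
    (degree_one_lt_prod_polya hg)), natDegree_prod_polya]

theorem eval_polyaPoly {g i : ℕ} (hi : i < g) : (polyaPoly g).eval (4 * (i : ℤ)) = -1 := by
  rw [polyaPoly, eval_sub, eval_prod, eval_one,
    Finset.prod_eq_zero (Finset.mem_range.2 hi) (by simp), zero_sub]

/-- If Pólya's polynomial is a product of two polynomials, these take opposite values `±1` at
the `g` points `4 i`, and their sum vanishes for reasons of degree. -/
theorem irreducible_polyaPoly {g : ℕ} (hg : 0 < g) : Irreducible (polyaPoly g) := by
  have hmon := monic_polyaPoly hg
  have hdeg := natDegree_polyaPoly hg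
  rw [hmon.irreducible_iff_natDegree']
  refine ⟨fun h => by rw [h, natDegree_one] at hdeg; omega, fun p q hp hq hpq hmem => ?_⟩
  rw [Finset.mem_Ioc, hdeg] at hmem
  have hadd : p.natDegree + q.natDegree = g := by rw [← hp.natDegree_mul hq, hpq, hdeg]
  have hlt : (p + q).natDegree < g := (natDegree_add_le p q).trans_lt (max_lt (by omega) (by omega))
  have hroot : ∀ i < g, (p + q).eval (4 * (i : ℤ)) = 0 := fun i hi => by
    have h := eval_polyaPoly hi
    rw [← hpq, eval_mul] at h
    rw [eval_add]
    rcases Int.mul_eq_neg_one_iff_eq_one_or_neg_one.1 h with ⟨h1, h2⟩ | ⟨h1, h2⟩ <;>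
      rw [h1, h2] <;> rfl
  have hzero : p + q = 0 := by
    refine eq_zero_of_natDegree_lt_card_of_eval_eq_zero' (p + q)
      ((Finset.range g).image fun i : ℕ => 4 * (i : ℤ)) (fun x hx => ?_) ?_
    · obtain ⟨i, hi, rfl⟩ := Finset.mem_image.1 hx
      exact hroot i (Finset.mem_range.1 hi)
    · rwa [Finset.card_image_of_injective _ (fun i j hij => by simpa using hij),
        Finset.card_range]
  have hlead := congrArg leadingCoeff (eq_neg_of_add_eq_zero_left hzero)
  rw [leadingCoeff_neg, hp.leadingCoeff, hq.leadingCoeff] at hlead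
  norm_num at hlead

/-- Near each of the points `4 i` Pólya's polynomial has a real root: it is negative at `4 i`, and
positive at one of the points `4 i ± 2`. -/
theorem exists_root_polyaPoly {g i : ℕ} (hi : i < g) :
    ∃ x : ℝ, |x - 4 * i| < 2 ∧ aeval x (polyaPoly g) = 0 := by
  let F : ℝ → ℝ := fun x => aeval x (polyaPoly g)
  have hF : Continuous F := (polyaPoly g).continuous_aeval
  have hcast : ∀ n : ℤ, F n = ((∏ j ∈ Finset.range g, (n - 4 * (j : ℤ)) - 1 : ℤ) : ℝ) := by
    intro n
    simp [F, polyaPoly, map_ofNat]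
  have hmid : F (4 * i) < 0 := by
    have h := hcast (4 * i)
    rw [Finset.prod_eq_zero (Finset.mem_range.2 hi) (by simp)] at h
    push_cast at h
    rw [h]
    norm_num
  set p := ∏ j ∈ Finset.range g, ((4 * (i : ℤ) + 2) - 4 * (j : ℤ)) with hp
  set q := ∏ j ∈ Finset.range g, ((4 * (i : ℤ) - 2) - 4 * (j : ℤ)) with hq
  have hpq : p * q < 0 := by
    rw [hp, hq, ← Finset.prod_mul_distrib, ← Finset.mul_prod_erase _ _ (Finset.mem_range.2 hi)]
    refine mul_neg_of_neg_of_pos (by ring_nf; norm_num) (Finset.prod_pos fun j hj => ?_)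
    have hji : (i : ℤ) - j ≠ 0 := by
      have := (Finset.mem_erase.1 hj).1
      omega
    have h1 : 1 ≤ |(i : ℤ) - j| := Int.one_le_abs hji
    nlinarith [sq_abs ((i : ℤ) - j)]
  have hp1 : p ≠ 1 := fun h => by
    have h2 : (2 : ℤ) ∣ p := Dvd.dvd.trans (by omega) (Finset.dvd_prod_of_mem _ (Finset.mem_range.2 hi))
    omega
  have hq1 : q ≠ 1 := fun h => by
    have h2 : (2 : ℤ) ∣ q := Dvd.dvd.trans (by omega) (Finset.dvd_prod_of_mem _ (Finset.mem_range.2 hi))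
    omega
  have hFp : F (4 * i + 2) = ((p - 1 : ℤ) : ℝ) := by
    rw [← hcast]
    push_cast
    rfl
  have hFq : F (4 * i - 2) = ((q - 1 : ℤ) : ℝ) := by
    rw [← hcast]
    push_cast
    rfl
  rcases mul_neg_iff.1 hpq with ⟨h, -⟩ | ⟨-, h⟩
  · have hpos : 0 < F (4 * i + 2) := by
      rw [hFp]
      exact_mod_cast (by omega : 0 < p - 1)
    obtain ⟨x, hx, hx0⟩ := intermediate_value_Ioo (by linarith : (4 * i : ℝ) ≤ 4 * i + 2)
      hF.continuousOn ⟨hmid, hpos⟩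
    exact ⟨x, by rw [abs_lt]; constructor <;> linarith [hx.1, hx.2], hx0⟩
  · have hpos : 0 < F (4 * i - 2) := by
      rw [hFq]
      exact_mod_cast (by omega : 0 < q - 1)
    obtain ⟨x, hx, hx0⟩ := intermediate_value_Ioo' (by linarith : (4 * i - 2 : ℝ) ≤ 4 * i)
      hF.continuousOn ⟨hmid, hpos⟩
    exact ⟨x, by rw [abs_lt]; constructor <;> linarith [hx.1, hx.2], hx0⟩

namespace Matrix

variable {g : ℕ}

/-- The companion matrix of a monic polynomial `p` of degree `g`: its columns are the coordinates of
`x * x ^ j` modulo `p` with respect to the basis `1, x, …, x ^ (g - 1)`. -/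
def companion (g : ℕ) (p : ℤ[X]) : Matrix (Fin g) (Fin g) ℤ :=
  Matrix.of fun i j =>
    if (j : ℕ) + 1 < g then (if (i : ℕ) = j + 1 then 1 else 0) else -p.coeff i

/-- Evaluation at a root of `p` is a left eigenvector of the companion matrix. -/
theorem powers_vecMul_companion {p : ℤ[X]} (hp : p.Monic) (hdeg : p.natDegree = g) {x : ℝ}
    (hx : aeval x p = 0) :
    (fun i : Fin g => x ^ (i : ℕ)) ᵥ* (companion g p).map (Int.cast : ℤ → ℝ)
      = x • fun i : Fin g => x ^ (i : ℕ) := by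
  funext j
  simp only [Matrix.vecMul, dotProduct, companion, Matrix.map_apply, Matrix.of_apply,
    Pi.smul_apply, smul_eq_mul]
  split_ifs with h
  · rw [Finset.sum_eq_single (⟨j + 1, h⟩ : Fin g)]
    · simp [pow_succ']
    · intro i _ hi
      have : (i : ℕ) ≠ j + 1 := fun h' => hi (Fin.ext h')
      simp [this]
    · simp
  · have hj : (j : ℕ) + 1 = g := by omega
    rw [aeval_eq_sum_range, hdeg, Finset.sum_range_succ, ← hdeg, hp.coeff_natDegree, hdeg,
      Finset.sum_range] at hx
    simp only [zsmul_eq_mul, Int.cast_one, one_mul] at hx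
    rw [← pow_succ', hj]
    simp only [Int.cast_neg, mul_neg, Finset.sum_neg_distrib]
    simp only [mul_comm (x ^ _)]
    linarith

theorem vecMul_aeval_of_vecMul_eq_smul {K : Type*} [Field K] {A : Matrix (Fin g) (Fin g) K}
    {v : Fin g → K} {x : K} (h : v ᵥ* A = x • v) (p : K[X]) : v ᵥ* aeval A p = p.eval x • v := by
  induction p using Polynomial.induction_on' with
  | add p q hp hq => rw [map_add, vecMul_add, hp, hq, eval_add, add_smul]
  | monomial n a =>
    rw [aeval_monomial, eval_monomial, ← Algebra.smul_def, Matrix.vecMul_smul, mul_smul]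
    congr 1
    induction n with
    | zero => simp
    | succ n ih => rw [pow_succ, ← vecMul_vecMul, ih, smul_vecMul, h, smul_smul, pow_succ]

theorem aeval_map_intCast (R : Type*) [CommRing R] (T : Matrix (Fin g) (Fin g) ℤ) (p : ℤ[X]) :
    aeval (T.map (Int.cast : ℤ → R)) p = (aeval T p).map (Int.cast : ℤ → R) :=
  aeval_algHom_apply (AlgHom.mapMatrix (Algebra.ofId ℤ R)) T p

/-- If `A` is a root of an irreducible polynomial whose degree is the dimension of the space, then
`A` has no nontrivial invariant subspaces: the vectors `A ^ i w` span the space for each `w ≠ 0`. -/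
theorem eq_bot_or_eq_top_of_aeval_eq_zero {K : Type*} [Field K] {A : Matrix (Fin g) (Fin g) K}
    {p : K[X]} (hp : Irreducible p) (hdeg : p.natDegree = g) (hA : aeval A p = 0)
    (S : Submodule K (Fin g → K)) (hS : ∀ w ∈ S, A *ᵥ w ∈ S) : S = ⊥ ∨ S = ⊤ := by
  refine or_iff_not_imp_left.2 fun hbot => ?_
  obtain ⟨w, hw, hw0⟩ := Submodule.exists_mem_ne_zero_of_ne_bot hbot
  have hmem : ∀ q : K[X], aeval A q *ᵥ w ∈ S := fun q => by
    induction q using Polynomial.induction_on' with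
    | add p q hp hq => rw [map_add, add_mulVec]; exact S.add_mem hp hq
    | monomial n a =>
      rw [aeval_monomial, ← Algebra.smul_def, smul_mulVec]
      refine S.smul_mem _ ?_
      induction n with
      | zero => simpa using hw
      | succ n ih => rw [pow_succ', ← mulVec_mulVec]; exact hS _ ih
  let φ : degreeLT K g →ₗ[K] S :=
    { toFun := fun q => ⟨aeval A q.1 *ᵥ w, hmem q.1⟩
      map_add' := fun q q' => Subtype.ext (by
        simp only [Submodule.coe_add, map_add, add_mulVec])
      map_smul' := fun c q => Subtype.ext (by
        simp only [Submodule.coe_smul, map_smul, smul_mulVec, RingHom.id_apply]) }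
  have hφ : Function.Injective φ := by
    rw [injective_iff_map_eq_zero]
    rintro ⟨q, hq⟩ h
    have h0 : aeval A q *ᵥ w = 0 := congrArg Subtype.val h
    by_contra hne
    have hq0 : q ≠ 0 := fun h => hne (Subtype.ext h)
    have hcop : IsCoprime p q := (hp.coprime_iff_not_dvd).2 fun hdvd => by
      have h1 := natDegree_le_of_dvd hdvd hq0
      rw [mem_degreeLT, degree_eq_natDegree hq0] at hq
      have : q.natDegree < g := by exact_mod_cast hq
      omega
    obtain ⟨a, c, hac⟩ := hcop
    have h2 : aeval A (a * p + c * q) *ᵥ w = w := by rw [hac, map_one, one_mulVec]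
    rw [map_add, map_mul, map_mul, hA, mul_zero, zero_add, ← mulVec_mulVec, h0, mulVec_zero] at h2
    exact hw0 h2.symm
  have hle := LinearMap.finrank_le_finrank_of_injective hφ
  rw [(degreeLTEquiv K g).finrank_eq, Module.finrank_fin_fun] at hle
  refine Submodule.eq_top_of_finrank_eq (le_antisymm (Submodule.finrank_le S) ?_)
  rwa [Module.finrank_fin_fun]

/-- For every `g ≥ 2` there is an invertible integer matrix `T` with an irreducible characteristic
polynomial and an eigenvalue outside the unit circle, which is self-adjoint with respect to an
integral inner product `G`. It is the companion matrix of Pólya's polynomial, and `G` is the trace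
form of the totally real field which is defined by this polynomial. -/
theorem exists_unimodular_selfAdjoint (hg : 2 ≤ g) : ∃ T T' G : Matrix (Fin g) (Fin g) ℤ,
    T * T' = 1 ∧ T' * T = 1 ∧ Gᵀ = G ∧ G * T = Tᵀ * G ∧
    (∀ x : Fin g → ℝ, x ≠ 0 → 0 < x ⬝ᵥ G.map (Int.cast : ℤ → ℝ) *ᵥ x) ∧
    (∃ z ∈ spectrum ℂ (T.map (Int.cast : ℤ → ℂ)), 1 < ‖z‖) ∧
    ∀ S : Submodule ℚ (Fin g → ℚ), (∀ w ∈ S, T.map (Int.cast : ℤ → ℚ) *ᵥ w ∈ S) →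
      S = ⊥ ∨ S = ⊤ := by
  have hg0 : 0 < g := by omega
  have hmon := monic_polyaPoly hg0
  have hdeg := natDegree_polyaPoly hg0
  choose α hα hroot using fun i : Fin g => exists_root_polyaPoly i.2
  have hinj : Function.Injective α := fun i j hij => by
    have h1 := abs_lt.1 (hα i)
    have h2 := abs_lt.1 (hα j)
    rw [hij] at h1
    have h3 : (i : ℝ) < j + 1 := by linarith
    have h4 : (j : ℝ) < i + 1 := by linarith
    have h5 : (i : ℕ) < j + 1 := by exact_mod_cast h3
    have h6 : (j : ℕ) < i + 1 := by exact_mod_cast h4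
    exact Fin.ext (by omega)
  set V := vandermonde α with hV
  have hdet : IsUnit V.det := isUnit_iff_ne_zero.2 (det_vandermonde_ne_zero_iff.2 hinj)
  set T := companion g (polyaPoly g) with hT
  set A := T.map (Int.cast : ℤ → ℝ) with hAdef
  have hrow : ∀ k, V k ᵥ* A = α k • V k := fun k =>
    powers_vecMul_companion hmon hdeg (hroot k)
  -- the companion matrix is a root of the polynomial
  have haeval : aeval T (polyaPoly g) = 0 := by
    have h1 : V * aeval A (polyaPoly g) = 0 := by
      funext k
      have := vecMul_aeval_of_vecMul_eq_smul (hrow k) ((polyaPoly g).map (algebraMap ℤ ℝ))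
      rw [aeval_map_algebraMap, eval_map_algebraMap, hroot, zero_smul] at this
      exact this
    have h2 : aeval A (polyaPoly g) = 0 := by
      rw [← Matrix.nonsing_inv_mul_cancel_left V (aeval A (polyaPoly g)) hdet, h1, mul_zero]
    rw [hAdef, aeval_map_intCast] at h2
    exact Matrix.map_injective (Int.cast_injective (α := ℝ)) (h2.trans (by ext; simp))
  -- its constant coefficient is `-1`, hence the matrix is invertible
  obtain ⟨Q, hQ⟩ : ∃ Q, polyaPoly g = X * Q - 1 := by
    obtain ⟨k, rfl⟩ : ∃ k, g = k + 1 := ⟨g - 1, by omega⟩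
    refine ⟨∏ i ∈ Finset.range k, (X - C (4 * ((i + 1 : ℕ) : ℤ))), ?_⟩
    rw [polyaPoly, Finset.prod_range_succ', mul_comm X]
    simp
  have hTT : T * aeval T Q = 1 := by
    rw [hQ, map_sub, map_mul, aeval_X, map_one] at haeval
    exact sub_eq_zero.1 haeval
  -- the Gram matrix of the trace form has integer entries
  have hsemi : SemiconjBy V A (diagonal α) := by
    funext k
    refine (hrow k).trans ?_
    funext i
    simp [diagonal_mul]
  let G : Matrix (Fin g) (Fin g) ℤ := fun i j => (T ^ ((i : ℕ) + j)).trace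
  have hG : G.map (Int.cast : ℤ → ℝ) = Vᵀ * V := by
    ext i j
    have h1 : (((T ^ ((i : ℕ) + j)).trace : ℤ) : ℝ) = (A ^ ((i : ℕ) + j)).trace := by
      have h2 : A ^ ((i : ℕ) + j) = (T ^ ((i : ℕ) + j)).map (Int.cast : ℤ → ℝ) :=
        (map_pow (Int.castRingHom ℝ).mapMatrix T _).symm
      rw [h2]
      simp [trace]
    have h3 : (A ^ ((i : ℕ) + j)).trace = ∑ k, α k ^ ((i : ℕ) + j) := by
      rw [← Matrix.nonsing_inv_mul_cancel_left V (A ^ ((i : ℕ) + j)) hdet,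
        (hsemi.pow_right _).eq, trace_mul_comm, Matrix.mul_nonsing_inv_cancel_right _ _ hdet,
        diagonal_pow, trace_diagonal]
      rfl
    have h4 : G i j = (T ^ ((i : ℕ) + j)).trace := rfl
    rw [Matrix.map_apply, h4, h1, h3, mul_apply]
    exact Finset.sum_congr rfl fun k _ => pow_add _ _ _
  have hcast : Function.Injective fun M : Matrix (Fin g) (Fin g) ℤ => M.map (Int.cast : ℤ → ℝ) :=
    Matrix.map_injective Int.cast_injective
  refine ⟨T, aeval T Q, G, hTT, mul_eq_one_comm.1 hTT, ?_, ?_, ?_, ?_, ?_⟩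
  · ext i j
    change (T ^ ((j : ℕ) + i)).trace = (T ^ ((i : ℕ) + j)).trace
    rw [add_comm]
  · refine hcast ?_
    have h1 : (G * T).map (Int.cast : ℤ → ℝ) = G.map (Int.cast : ℤ → ℝ) * A :=
      Matrix.map_mul (f := Int.castRingHom ℝ)
    have h2 : (Tᵀ * G).map (Int.cast : ℤ → ℝ) = Aᵀ * G.map (Int.cast : ℤ → ℝ) := by
      rw [hAdef, ← transpose_map]
      exact Matrix.map_mul (f := Int.castRingHom ℝ)
    have h3 : V * A = diagonal α * V := hsemi.eq
    simp only [h1, h2, hG]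
    rw [Matrix.mul_assoc, h3, ← Matrix.mul_assoc, ← Matrix.mul_assoc, ← transpose_mul, h3,
      transpose_mul, diagonal_transpose]
  · intro x hx
    rw [hG, ← mulVec_mulVec, dotProduct_mulVec, vecMul_transpose]
    have hne : V *ᵥ x ≠ 0 := fun h0 => hx (by
      have := congrArg (V⁻¹ *ᵥ ·) h0
      simpa [mulVec_mulVec, Matrix.nonsing_inv_mul V hdet] using this)
    refine lt_of_le_of_ne (Finset.sum_nonneg fun k _ => mul_self_nonneg _) fun h0 => hne ?_
    exact dotProduct_self_eq_zero.1 h0.symm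
  · let i₁ : Fin g := ⟨1, by omega⟩
    have hbig : 2 < α i₁ := by
      have := (abs_lt.1 (hα i₁)).1
      simp only [i₁, Nat.cast_one] at this
      linarith
    refine ⟨(α i₁ : ℂ), ?_, ?_⟩
    · rw [spectrum.mem_iff]
      intro hu
      let v : Fin g → ℂ := fun i => (V i₁ i : ℂ)
      have hv : v ᵥ* T.map (Int.cast : ℤ → ℂ) = (α i₁ : ℂ) • v := by
        funext j
        have h := congrArg (Complex.ofReal) (congrFun (hrow i₁) j)
        simp only [vecMul, dotProduct, hAdef, map_apply, Pi.smul_apply, smul_eq_mul,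
          Complex.ofReal_sum, Complex.ofReal_mul, Complex.ofReal_intCast] at h
        exact h
      have hzero : v ᵥ* (algebraMap ℂ _ (α i₁ : ℂ) - T.map (Int.cast : ℤ → ℂ)) = 0 := by
        rw [vecMul_sub, hv, Algebra.algebraMap_eq_smul_one, vecMul_smul, vecMul_one, sub_self]
      obtain ⟨u, hu⟩ := hu
      have hv0 : v = 0 := by
        have := congrArg (· ᵥ* (↑u⁻¹ : Matrix (Fin g) (Fin g) ℂ)) hzero
        simpa [← hu, vecMul_vecMul] using this
      have := congrFun hv0 ⟨0, hg0⟩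
      simp [v, hV, vandermonde_apply] at this
    · rw [Complex.norm_real, Real.norm_eq_abs]
      exact lt_of_lt_of_le (by linarith) (le_abs_self _)
  · refine eq_bot_or_eq_top_of_aeval_eq_zero (p := (polyaPoly g).map (algebraMap ℤ ℚ))
      (hmon.irreducible_iff_irreducible_map_fraction_map.1 (irreducible_polyaPoly hg0))
      (by rw [hmon.natDegree_map, hdeg]) ?_
    rw [aeval_map_algebraMap, aeval_map_intCast, haeval]
    ext
    simp

end Matrix

end CompanionMatrix

/-! ### Specialization of a transcendental parameter -/

namespace TranscendentalSpecialization

open Polynomial Module Matrix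

/-- Let `p 0, …, p (k-1)` be vectors of rational polynomials. If their values at a transcendental
number span a space of dimension less than `k`, then their values at each rational number are
linearly dependent: a maximal minor which does not vanish at a rational number is a nonzero
polynomial. -/
theorem not_linearIndependent_eval {g k : ℕ} {s : ℂ} (hs : Transcendental ℚ s)
    (p : Fin k → Fin g → ℚ[X]) (V : Submodule ℂ (Fin g → ℂ)) (hV : finrank ℂ V < k)
    (hp : ∀ j, (fun i => aeval s (p j i)) ∈ V) (r : ℚ) :
    ¬ LinearIndependent ℚ fun j i => (p j i).eval r := by
  intro hli
  let M : Matrix (Fin g) (Fin k) ℚ[X] := Matrix.of fun i j => p j i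
  have hinj : LinearMap.ker (Fintype.linearCombination ℚ fun j i => (p j i).eval r) = ⊥ :=
    LinearMap.ker_eq_bot_of_injective hli.fintypeLinearCombination_injective
  obtain ⟨L, hL⟩ := LinearMap.exists_leftInverse_of_injective _ hinj
  let N : Matrix (Fin k) (Fin g) ℚ := LinearMap.toMatrix' L
  have hN : N * M.map (eval r) = 1 := by
    have h1 : LinearMap.toMatrix' (Fintype.linearCombination ℚ fun j i => (p j i).eval r)
        = M.map (eval r) := by
      ext i j
      simp [LinearMap.toMatrix'_apply, Fintype.linearCombination_apply_single, M]
    rw [← h1, ← LinearMap.toMatrix'_comp, hL, LinearMap.toMatrix'_id]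
  let D : ℚ[X] := (N.map C * M).det
  have hDr : D.eval r = 1 := by
    have h := RingHom.map_det (evalRingHom r) (N.map C * M)
    rw [coe_evalRingHom] at h
    rw [h, RingHom.mapMatrix_apply, Matrix.map_mul]
    have h2 : (N.map C).map (evalRingHom r) = N := by
      ext i j
      simp
    rw [h2]
    exact (congrArg Matrix.det hN).trans det_one
  have hDs : aeval s D = 0 := by
    have h := RingHom.map_det (aeval (R := ℚ) s).toRingHom (N.map C * M)
    refine h.trans ?_
    rw [RingHom.mapMatrix_apply, Matrix.map_mul]
    obtain ⟨c, hc, hc0⟩ : ∃ c : Fin k → ℂ, ∑ j, c j • (fun i => aeval s (p j i)) = 0 ∧ c ≠ 0 := by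
      have hdep : ¬ LinearIndependent ℂ fun j => (⟨_, hp j⟩ : V) := fun h => by
        have := h.fintype_card_le_finrank
        rw [Fintype.card_fin] at this
        omega
      obtain ⟨c, hc, j, hj⟩ := Fintype.not_linearIndependent_iff.1 hdep
      refine ⟨c, ?_, fun h => hj (congrFun h j)⟩
      have := congrArg (V.subtype) hc
      rw [map_sum, map_zero] at this
      exact this
    refine exists_mulVec_eq_zero_iff.1 ⟨c, hc0, ?_⟩
    have hMc : M.map (aeval (R := ℚ) s).toRingHom *ᵥ c = 0 := by
      rw [← hc]
      funext i
      simp only [mulVec, dotProduct, Finset.sum_apply, Pi.smul_apply, smul_eq_mul]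
      exact Finset.sum_congr rfl fun j _ => mul_comm _ _
    rw [← mulVec_mulVec, hMc, mulVec_zero]
  have hD0 : D ≠ 0 := fun h => by
    rw [h, eval_zero] at hDr
    exact zero_ne_one hDr
  exact hs ⟨D, hD0, hDs⟩

/-- The value at `s` of the polynomial `s a + (s ^ 2 - 1) (b + s T b)` of the parameter `s`. Up to
sign, it is the projection to `b` at `s = 0`, and the projection to `a` at `s = 1`; the ratio of the
coefficients of `b` and `a` is purely imaginary for `s ∈ i ℝ`, and the one of `T b` and `a` is
real. -/
def pencil {K : Type*} [Field K] {g : ℕ} (T : Matrix (Fin g) (Fin g) K) (s : K) :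
    ((Fin g → K) × (Fin g → K)) →ₗ[K] (Fin g → K) :=
  s • LinearMap.fst K _ _ + (s ^ 2 - 1) • (LinearMap.snd K _ _
    + s • (T.mulVecLin ∘ₗ LinearMap.snd K _ _))

theorem pencil_apply {K : Type*} [Field K] {g : ℕ} (T : Matrix (Fin g) (Fin g) K) (s : K)
    (w : (Fin g → K) × (Fin g → K)) :
    pencil T s w = s • w.1 + (s ^ 2 - 1) • (w.2 + s • T *ᵥ w.2) := rfl

variable {g : ℕ} (T : Matrix (Fin g) (Fin g) ℚ)

/-- The complex vector with the rational coordinates `v`. -/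
def toComplex {g : ℕ} : (Fin g → ℚ) →ₗ[ℚ] (Fin g → ℂ) where
  toFun v i := v i
  map_add' v w := by
    funext i
    simp
  map_smul' c v := by
    funext i
    simp [Algebra.smul_def]

/-- The rational vectors whose image under the pencil at `s` lies in `V`. -/
noncomputable def rationalPart (s : ℂ) (V : Submodule ℂ (Fin g → ℂ)) :
    Submodule ℚ ((Fin g → ℚ) × (Fin g → ℚ)) :=
  (V.restrictScalars ℚ).comap (((pencil (T.map (Rat.cast : ℚ → ℂ)) s).restrictScalars ℚ) ∘ₗ
    toComplex.prodMap toComplex)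

variable {T}

theorem mem_rationalPart {s : ℂ} {V : Submodule ℂ (Fin g → ℂ)}
    {w : (Fin g → ℚ) × (Fin g → ℚ)} : w ∈ rationalPart T s V ↔
      pencil (T.map (Rat.cast : ℚ → ℂ)) s (toComplex w.1, toComplex w.2) ∈ V := Iff.rfl

/-- Specialization from the transcendental parameter `s` to the rational parameter `r` does not
increase the rank of the pencil. -/
theorem finrank_map_pencil_le {s : ℂ} (hs : Transcendental ℚ s) (V : Submodule ℂ (Fin g → ℂ))
    (r : ℚ) : finrank ℚ ((rationalPart T s V).map (pencil T r)) ≤ finrank ℂ V := by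
  by_contra! hlt
  obtain ⟨f, hf⟩ := exists_linearIndependent_of_le_finrank (Nat.succ_le_of_lt hlt)
  choose w hw hwf using fun j => (f j).2
  let p : Fin (finrank ℂ V).succ → Fin g → ℚ[X] := fun j i =>
    X * C ((w j).1 i) + (X ^ 2 - 1) * (C ((w j).2 i) + X * C ((T *ᵥ (w j).2) i))
  refine not_linearIndependent_eval hs p V (Nat.lt_succ_self _) (fun j => ?_) r ?_
  · convert mem_rationalPart.1 (hw j) using 1
    funext i
    have h : ((T *ᵥ (w j).2) i : ℂ) = ((T.map (Rat.cast : ℚ → ℂ)) *ᵥ toComplex (w j).2) i := by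
      simp [mulVec, dotProduct, toComplex]
    simp only [p, pencil_apply, Pi.add_apply, Pi.smul_apply, smul_eq_mul, ← h]
    simp [toComplex]
    ring
  · have h : (fun j i => (p j i).eval r) = fun j => ((f j : Fin g → ℚ)) := by
      funext j i
      rw [← hwf j]
      simp [p, pencil_apply]
      ring
    rw [h]
    exact hf.map' (Submodule.subtype _) (Submodule.ker_subtype _)

/-- Let `T` have no invariant subspaces. If the rational part of `V` is as large as possible, then
`V` is trivial. The specializations of the pencil at `0` and `1` show that the rational part is a
product `U₁ × U₂`, and those at `2` and `-2` show that `U₁ = U₂` is invariant under `T`. -/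
theorem finrank_eq_zero_or_eq {s : ℂ} (hs : Transcendental ℚ s) (V : Submodule ℂ (Fin g → ℂ))
    (hT : ∀ S : Submodule ℚ (Fin g → ℚ), (∀ w ∈ S, T *ᵥ w ∈ S) → S = ⊥ ∨ S = ⊤)
    (hdim : 2 * finrank ℂ V ≤ finrank ℚ (rationalPart T s V)) :
    finrank ℂ V = 0 ∨ finrank ℂ V = g := by
  set W := rationalPart T s V
  set m := finrank ℂ V
  have hfst : pencil T 1 = LinearMap.fst ℚ _ _ := by
    refine LinearMap.ext fun w => ?_
    rw [pencil_apply]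
    simp
  have hsnd : pencil T 0 = -LinearMap.snd ℚ _ _ := by
    refine LinearMap.ext fun w => ?_
    rw [pencil_apply]
    simp
  set U₁ := W.map (LinearMap.fst ℚ (Fin g → ℚ) (Fin g → ℚ)) with hU₁
  set U₂ := W.map (LinearMap.snd ℚ (Fin g → ℚ) (Fin g → ℚ)) with hU₂
  have h1 : finrank ℚ U₁ ≤ m := by
    rw [hU₁, ← hfst]
    exact finrank_map_pencil_le hs V 1
  have h2 : finrank ℚ U₂ ≤ m := by
    have := finrank_map_pencil_le (T := T) hs V 0
    rwa [hsnd, Submodule.map_neg] at this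
  have hle : W ≤ U₁.prod U₂ := fun w hw => ⟨⟨w, hw, rfl⟩, ⟨w, hw, rfl⟩⟩
  have hprod : finrank ℚ (U₁.prod U₂) = finrank ℚ U₁ + finrank ℚ U₂ := by
    have hinj : Function.Injective (U₁.subtype.prodMap U₂.subtype) :=
      Prod.map_injective.2 ⟨U₁.injective_subtype, U₂.injective_subtype⟩
    rw [← finrank_prod, ← LinearMap.finrank_range_of_inj hinj, LinearMap.range_prodMap,
      Submodule.range_subtype, Submodule.range_subtype]
  have hW : W = U₁.prod U₂ := Submodule.eq_of_le_of_finrank_le hle (by omega)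
  rw [hW, hprod] at hdim
  have hmem₁ : ∀ r : ℚ, r ≠ 0 → W.map (pencil T r) = U₁ := fun r hr => by
    refine (Submodule.eq_of_le_of_finrank_le (fun a ha => ?_)
      ((finrank_map_pencil_le hs V r).trans (by omega))).symm
    refine ⟨(r⁻¹ • a, 0), hW.ge ⟨U₁.smul_mem _ ha, U₂.zero_mem⟩, ?_⟩
    rw [pencil_apply]
    simp [smul_smul, mul_inv_cancel₀ hr]
  have hmem : ∀ r : ℚ, r ≠ 0 → ∀ b ∈ U₂, (r ^ 2 - 1) • (b + r • T *ᵥ b) ∈ U₁ := fun r hr b hb => by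
    rw [← hmem₁ r hr]
    refine ⟨(0, b), hW.ge ⟨U₁.zero_mem, hb⟩, ?_⟩
    rw [pencil_apply]
    simp
  have hb : ∀ b ∈ U₂, b ∈ U₁ ∧ T *ᵥ b ∈ U₁ := fun b hb => by
    have hp := hmem 2 (by norm_num) b hb
    have hn := hmem (-2) (by norm_num) b hb
    constructor
    · have := U₁.smul_mem (1 / 6 : ℚ) (U₁.add_mem hp hn)
      convert this using 1
      module
    · have := U₁.smul_mem (1 / 12 : ℚ) (U₁.sub_mem hp hn)
      convert this using 1
      module
  have hU : U₂ = U₁ := Submodule.eq_of_le_of_finrank_le (fun b hb' => (hb b hb').1) (by omega)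
  rcases hT U₂ (fun b hb' => hU ▸ (hb b hb').2) with h | h
  · left
    rw [← hU, h, finrank_bot] at hdim
    omega
  · right
    rw [h, finrank_top, finrank_fin_fun] at h2
    rw [← hU, h, finrank_top, finrank_fin_fun] at hdim
    omega

end TranscendentalSpecialization

/-! ### A simple abelian variety with real multiplication by `T` -/

namespace ComplexTorus

open Module Matrix TranscendentalSpecialization

variable {g : ℕ}

section PeriodTorus

variable (T : Matrix (Fin g) (Fin g) ℤ) (y : ℝ)

/-- The map `(a, b) ↦ a + τ b`, where `τ = i (y ^ 2 + 1) / y - (y ^ 2 + 1) T`. -/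
noncomputable def period : ((Fin g → ℝ) × (Fin g → ℝ)) →ₗ[ℝ] (Fin g → ℂ) where
  toFun w i := (w.1 i - (y ^ 2 + 1) * (T.map (Int.cast : ℤ → ℝ) *ᵥ w.2) i : ℝ)
    + ((y ^ 2 + 1) / y * w.2 i : ℝ) * Complex.I
  map_add' w w' := by
    funext i
    simp only [Prod.fst_add, Prod.snd_add, mulVec_add, Pi.add_apply]
    push_cast
    ring
  map_smul' c w := by
    funext i
    simp only [Prod.smul_fst, Prod.smul_snd, mulVec_smul, Pi.smul_apply, smul_eq_mul,
      RingHom.id_apply, Complex.real_smul]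
    push_cast
    ring

variable {y}

theorem period_re (w : (Fin g → ℝ) × (Fin g → ℝ)) :
    (fun i => (period T y w i).re)
      = w.1 - (y ^ 2 + 1) • (T.map (Int.cast : ℤ → ℝ) *ᵥ w.2) := by
  funext i
  change (((_ : ℝ) : ℂ) + ((_ : ℝ) : ℂ) * Complex.I).re = _
  rw [Complex.add_re, Complex.ofReal_re, Complex.re_ofReal_mul, Complex.I_re, mul_zero, add_zero]
  rfl

theorem period_im (w : (Fin g → ℝ) × (Fin g → ℝ)) :
    (fun i => (period T y w i).im) = ((y ^ 2 + 1) / y) • w.2 := by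
  funext i
  change (((_ : ℝ) : ℂ) + ((_ : ℝ) : ℂ) * Complex.I).im = _
  rw [Complex.add_im, Complex.ofReal_im, Complex.im_ofReal_mul, Complex.I_im, mul_one, zero_add]
  rfl

theorem period_bijective (hy : 0 < y) : Function.Bijective (period T y) := by
  have hc : (y ^ 2 + 1) / y ≠ 0 := by positivity
  have hinj : Function.Injective (period T y) := by
    rw [injective_iff_map_eq_zero]
    rintro ⟨a, b⟩ h
    have him := period_im T (y := y) (a, b)
    have hre := period_re T (y := y) (a, b)
    rw [h] at him hre
    have hb : b = 0 := (smul_eq_zero.1 him.symm).resolve_left hc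
    subst hb
    rw [mulVec_zero, smul_zero, sub_zero] at hre
    exact Prod.ext hre.symm rfl
  refine ⟨hinj, ?_⟩
  refine (LinearMap.injective_iff_surjective_of_finrank_eq_finrank ?_).1 hinj
  rw [finrank_prod, finrank_fin_fun, ← finrank_mul_finrank ℝ ℂ (Fin g → ℂ), finrank_fin_fun,
    Complex.finrank_real_complex, two_mul]

variable (y)

/-- The columns of the period matrix `(1, τ)`. -/
noncomputable def periodBasis (hy : 0 < y) : Basis (Fin g ⊕ Fin g) ℝ (Fin g → ℂ) :=
  ((Pi.basisFun ℝ (Fin g)).prod (Pi.basisFun ℝ (Fin g))).map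
    (LinearEquiv.ofBijective (period T y) (period_bijective T hy))

/-- The complex torus `ℂ^g / (ℤ^g + τ ℤ^g)`, where `τ = i (y ^ 2 + 1) / y - (y ^ 2 + 1) T`. -/
noncomputable def periodTorus (hy : 0 < y) : ComplexTorus g where
  lattice := Submodule.span ℤ (Set.range (periodBasis T y hy))
  discrete := inferInstance
  span_top := by
    rw [Submodule.span_span_of_tower]
    exact (periodBasis T y hy).span_eq

/-- The real vector with the integer coordinates `a`. -/
def toReal (a : Fin g → ℤ) : Fin g → ℝ := fun i => a i

variable {y}

theorem mem_lattice_periodTorus (hy : 0 < y) (v : Fin g → ℂ) :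
    v ∈ (periodTorus T y hy).lattice ↔
      ∃ a b : Fin g → ℤ, v = period T y (toReal a, toReal b) := by
  change v ∈ Submodule.span ℤ (Set.range (periodBasis T y hy)) ↔ _
  rw [Basis.mem_span_iff_repr_mem ℤ]
  obtain ⟨w, rfl⟩ := (period_bijective T hy).2 v
  have hsymm : (LinearEquiv.ofBijective (period T y) (period_bijective T hy)).symm
      (period T y w) = w :=
    (LinearEquiv.ofBijective (period T y) (period_bijective T hy)).symm_apply_apply w
  have hrepr : (periodBasis T y hy).repr (period T y w)
      = ((Pi.basisFun ℝ (Fin g)).prod (Pi.basisFun ℝ (Fin g))).repr w := by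
    rw [periodBasis, Basis.map_repr, LinearEquiv.trans_apply, hsymm]
  rw [hrepr]
  constructor
  · intro h
    choose c hc using h
    refine ⟨fun i => c (Sum.inl i), fun i => c (Sum.inr i), congrArg _ (Prod.ext ?_ ?_)⟩
    · funext i
      have := hc (Sum.inl i)
      simp only [Basis.prod_repr_inl, Pi.basisFun_repr] at this
      exact this.symm
    · funext i
      have := hc (Sum.inr i)
      simp only [Basis.prod_repr_inr, Pi.basisFun_repr] at this
      exact this.symm
  · rintro ⟨a, b, h⟩
    rw [(period_bijective T hy).1 h]
    rintro (i | i)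
    · exact ⟨a i, by simp [toReal]⟩
    · exact ⟨b i, by simp [toReal]⟩

theorem toReal_mulVec (U : Matrix (Fin g) (Fin g) ℤ) (a : Fin g → ℤ) :
    U.map (Int.cast : ℤ → ℝ) *ᵥ toReal a = toReal (U *ᵥ a) := by
  funext i
  simp [mulVec, dotProduct, toReal]

theorem toReal_dotProduct (a b : Fin g → ℤ) : toReal a ⬝ᵥ toReal b = ((a ⬝ᵥ b : ℤ) : ℝ) := by
  simp [dotProduct, toReal]

end PeriodTorus

theorem star_dotProduct_mulVec (S : Matrix (Fin g) (Fin g) ℝ) (z w : Fin g → ℂ) :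
    star z ⬝ᵥ S.map Complex.ofReal *ᵥ w =
      (((fun i => (z i).re) ⬝ᵥ S *ᵥ (fun i => (w i).re)
        + (fun i => (z i).im) ⬝ᵥ S *ᵥ (fun i => (w i).im) : ℝ) : ℂ)
      + (((fun i => (z i).re) ⬝ᵥ S *ᵥ (fun i => (w i).im)
        - (fun i => (z i).im) ⬝ᵥ S *ᵥ (fun i => (w i).re) : ℝ) : ℂ) * Complex.I := by
  simp only [dotProduct, mulVec, Pi.star_apply, Finset.mul_sum, map_apply, Complex.ofReal_add,
    Complex.ofReal_sub, Complex.ofReal_sum, Complex.ofReal_mul, ← Finset.sum_add_distrib,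
    ← Finset.sum_sub_distrib, Finset.sum_mul]
  refine Finset.sum_congr rfl fun i _ => Finset.sum_congr rfl fun j _ => ?_
  have hz : star (z i) = (z i).re - (z i).im * Complex.I := by
    apply Complex.ext <;> simp
  have hw : w j = (w j).re + (w j).im * Complex.I := (Complex.re_add_im _).symm
  rw [hz]
  conv_lhs => rw [hw]
  linear_combination (-((z i).im * S i j * (w j).im : ℂ)) * Complex.I_sq

/-- If `T` is self-adjoint with respect to the integral inner product `G`, then the Hermitian
form `G / c`, where `c = (y ^ 2 + 1) / y`, is a polarization of the torus with lattice
`ℤ^g + τ ℤ^g`, where `τ = i c - (y ^ 2 + 1) T`: its imaginary part is the form `(a + τ b, a' + τ b') ↦ a G b' - b G a'`. -/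
theorem isAbelianVariety_periodTorus {T G : Matrix (Fin g) (Fin g) ℤ} {y : ℝ} (hy : 0 < y)
    (hG : Gᵀ = G) (hGT : G * T = Tᵀ * G)
    (hpos : ∀ x : Fin g → ℝ, x ≠ 0 → 0 < x ⬝ᵥ G.map (Int.cast : ℤ → ℝ) *ᵥ x) :
    (periodTorus T y hy).IsAbelianVariety := by
  set c := (y ^ 2 + 1) / y with hc
  have hc0 : 0 < c := by positivity
  set S := G.map (Int.cast : ℤ → ℝ) with hS
  have hsymm : Sᵀ = S := by rw [hS, ← transpose_map, hG]
  refine ⟨(c⁻¹ • S).map Complex.ofReal, ?_, ?_, ?_⟩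
  · ext i j
    have : S j i = S i j := congrFun (congrFun hsymm i) j
    simp [conjTranspose_apply, this]
  · intro x hx
    rw [star_dotProduct_mulVec]
    have hnn : ∀ v : Fin g → ℝ, 0 ≤ v ⬝ᵥ S *ᵥ v := fun v => by
      by_cases hv : v = 0
      · simp [hv]
      · exact (hpos v hv).le
    simp only [smul_mulVec, dotProduct_smul, smul_eq_mul, ← mul_add]
    rw [Complex.add_re, Complex.ofReal_re, Complex.re_ofReal_mul, Complex.I_re, mul_zero, add_zero]
    refine mul_pos (inv_pos.2 hc0) ?_
    by_cases hre : (fun i => (x i).re) = 0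
    · have him : (fun i => (x i).im) ≠ 0 := fun him =>
        hx (funext fun i => Complex.ext (congrFun hre i) (congrFun him i))
      exact add_pos_of_nonneg_of_pos (hnn _) (hpos _ him)
    · exact add_pos_of_pos_of_nonneg (hpos _ hre) (hnn _)
  · intro x hx x' hx'
    obtain ⟨a, b, rfl⟩ := (mem_lattice_periodTorus T hy x).1 hx
    obtain ⟨a', b', rfl⟩ := (mem_lattice_periodTorus T hy x').1 hx'
    refine ⟨a ⬝ᵥ G *ᵥ b' - b ⬝ᵥ G *ᵥ a', ?_⟩
    rw [star_dotProduct_mulVec, Complex.add_im, Complex.ofReal_im, zero_add, Complex.im_ofReal_mul,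
      Complex.I_im, mul_one, period_re, period_im, period_re, period_im, ← hc]
    simp only [toReal_mulVec, smul_mulVec, mulVec_smul, mulVec_sub, dotProduct_smul,
      smul_dotProduct, sub_dotProduct, dotProduct_sub, smul_eq_mul, hS, toReal_dotProduct]
    have h1 : T *ᵥ b ⬝ᵥ G *ᵥ b' = b ⬝ᵥ G *ᵥ T *ᵥ b' := by
      rw [mulVec_mulVec, hGT, ← mulVec_mulVec, dotProduct_mulVec b, vecMul_transpose]
    rw [h1]
    push_cast
    field_simp
    ring

/-- The endomorphism of a complex torus induced by a matrix which preserves the lattice. -/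
noncomputable def endoOfMatrix (X : ComplexTorus g) (A : Matrix (Fin g) (Fin g) ℂ)
    (hA : ∀ l ∈ X.lattice, A *ᵥ l ∈ X.lattice) : X.endo :=
  ⟨(Submodule.mapQ X.lattice X.lattice (A.mulVecLin.restrictScalars ℤ) hA).toAddMonoidHom,
    fun v => ⟨A.mulVec, (LinearMap.toContinuousLinearMap A.mulVecLin).analyticAt v,
      Filter.Eventually.of_forall fun _ => rfl⟩⟩

theorem endoOfMatrix_proj (X : ComplexTorus g) {A : Matrix (Fin g) (Fin g) ℂ}
    (hA : ∀ l ∈ X.lattice, A *ᵥ l ∈ X.lattice) (v : Fin g → ℂ) :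
    (X.endoOfMatrix A hA).1 (X.proj v) = X.proj (A *ᵥ v) := rfl

theorem endoOfMatrix_mul_eq_one (X : ComplexTorus g) {A A' : Matrix (Fin g) (Fin g) ℂ}
    (hA : ∀ l ∈ X.lattice, A *ᵥ l ∈ X.lattice) (hA' : ∀ l ∈ X.lattice, A' *ᵥ l ∈ X.lattice)
    (h : A * A' = 1) : X.endoOfMatrix A hA * X.endoOfMatrix A' hA' = 1 := by
  refine Subtype.ext (AddMonoidHom.ext fun x => ?_)
  obtain ⟨v, rfl⟩ := X.proj_surjective x
  change (X.endoOfMatrix A hA).1 ((X.endoOfMatrix A' hA').1 (X.proj v)) = X.proj v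
  rw [endoOfMatrix_proj, endoOfMatrix_proj, mulVec_mulVec, h, one_mulVec]

/-- Integer matrices which commute with `T` preserve the lattice `ℤ^g + τ ℤ^g`. -/
theorem mulVec_mem_lattice_periodTorus {T U : Matrix (Fin g) (Fin g) ℤ} {y : ℝ} (hy : 0 < y)
    (hU : U * T = T * U) (l : Fin g → ℂ) (hl : l ∈ (periodTorus T y hy).lattice) :
    U.map (Int.cast : ℤ → ℂ) *ᵥ l ∈ (periodTorus T y hy).lattice := by
  obtain ⟨a, b, rfl⟩ := (mem_lattice_periodTorus T hy l).1 hl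
  refine (mem_lattice_periodTorus T hy _).2 ⟨U *ᵥ a, U *ᵥ b, ?_⟩
  have hcomplex : ∀ z : Fin g → ℂ, U.map (Int.cast : ℤ → ℂ) *ᵥ z = fun i =>
      (((U.map (Int.cast : ℤ → ℝ) *ᵥ fun j => (z j).re) i : ℝ) : ℂ)
      + (((U.map (Int.cast : ℤ → ℝ) *ᵥ fun j => (z j).im) i : ℝ) : ℂ) * Complex.I := fun z => by
    funext i
    simp only [mulVec, dotProduct, map_apply, Complex.ofReal_sum, Complex.ofReal_mul,
      Complex.ofReal_intCast, Finset.sum_mul, ← Finset.sum_add_distrib]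
    refine Finset.sum_congr rfl fun j _ => ?_
    conv_lhs => rw [← Complex.re_add_im (z j)]
    ring
  have hsplit : ∀ z : Fin g → ℂ, z = fun i => ((z i).re : ℂ) + ((z i).im : ℂ) * Complex.I :=
    fun z => funext fun i => (Complex.re_add_im _).symm
  rw [hcomplex, period_re, period_im, hsplit (period T y (toReal (U *ᵥ a), toReal (U *ᵥ b)))]
  have hre := fun i => congrFun (period_re T (y := y) (toReal (U *ᵥ a), toReal (U *ᵥ b))) i
  have him := fun i => congrFun (period_im T (y := y) (toReal (U *ᵥ a), toReal (U *ᵥ b))) i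
  funext i
  simp only [hre, him]
  simp only [mulVec_sub, mulVec_smul, toReal_mulVec, mulVec_mulVec, hU]

/-- A complex torus is simple if every complex subspace which is spanned by as many lattice vectors
as its real dimension is trivial. -/
theorem isSimple_of_subspaces (X : ComplexTorus g)
    (h : ∀ (m : ℕ) (B : (Fin m → ℂ) →ₗ[ℂ] (Fin g → ℂ)), Function.Injective B →
      (∃ e : Fin (2 * m) → (Fin m → ℂ), LinearIndependent ℝ e ∧ ∀ i, B (e i) ∈ X.lattice) →
      m = 0 ∨ m = g) : X.IsSimple := by
  intro m Y _ i hi hinj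
  obtain ⟨B, hB⟩ := exists_linear_lift i hi
  have hBinj : Function.Injective B := by
    rw [injective_iff_map_eq_zero]
    intro w hw
    refine Y.eq_zero_of_smul_mem fun t => ?_
    have h0 : i (Y.proj (t • w)) = 0 := by rw [hB, map_smul, hw, smul_zero, map_zero]
    have h1 : Y.proj (t • w) = Y.proj 0 := by
      rw [map_zero]
      exact hinj (h0.trans (map_zero i).symm)
    simpa using (Y.proj_eq_iff _ _).1 h1
  have hlat : ∀ l ∈ Y.lattice, B l ∈ X.lattice := fun l hl => by
    have h1 : Y.proj l = 0 := ((Y.proj_eq_iff l 0).2 (by simpa using hl)).trans (map_zero _)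
    have h2 := hB l
    rw [h1, map_zero] at h2
    simpa using (X.proj_eq_iff _ 0).1 (h2.symm.trans (map_zero _).symm)
  rcases h m B hBinj ⟨Y.realBasis, Y.realBasis.linearIndependent, fun k => hlat _ (by
    rw [realBasis_apply]
    exact (Y.latticeBasis k).2)⟩ with rfl | rfl
  · left
    rw [eq_bot_iff]
    rintro _ ⟨x, rfl⟩
    obtain ⟨v, rfl⟩ := Y.proj_surjective x
    rw [AddSubgroup.mem_bot, Subsingleton.elim v 0, map_zero, map_zero]
  · right
    rw [AddMonoidHom.range_eq_top]
    intro x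
    obtain ⟨v, rfl⟩ := X.proj_surjective x
    obtain ⟨w, rfl⟩ := (LinearMap.injective_iff_surjective (f := B.toLinearMap)).1 hBinj v
    exact ⟨Y.proj w, hB w⟩

/-- The pencil at `i y` is the period map, up to a factor `i y`. -/
theorem pencil_eq_smul_period (T : Matrix (Fin g) (Fin g) ℤ) {y : ℝ} (hy : 0 < y)
    (a b : Fin g → ℤ) :
    pencil ((T.map (Int.cast : ℤ → ℚ)).map (Rat.cast : ℚ → ℂ)) (y * Complex.I)
      (toComplex (fun i => (a i : ℚ)), toComplex fun i => (b i : ℚ))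
      = (y * Complex.I) • period T y (toReal a, toReal b) := by
  have hy' : (y : ℂ) ≠ 0 := by exact_mod_cast hy.ne'
  funext i
  have h1 : (((T.map (Int.cast : ℤ → ℚ)).map (Rat.cast : ℚ → ℂ)) *ᵥ
      toComplex fun i => (b i : ℚ)) i = (((T *ᵥ b) i : ℤ) : ℂ) := by
    simp [mulVec, dotProduct, toComplex]
  rw [pencil_apply]
  simp only [Pi.add_apply, Pi.smul_apply, smul_eq_mul, h1, period, LinearMap.coe_mk,
    AddHom.coe_mk, toReal_mulVec]
  simp only [toComplex, toReal, LinearMap.coe_mk, AddHom.coe_mk]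
  push_cast
  field_simp
  have hI : Complex.I ^ 2 = -1 := Complex.I_sq
  linear_combination ((y : ℂ) ^ 2 * b i + y ^ 3 * Complex.I * ((T *ᵥ b) i : ℤ)
    - (y ^ 2 + 1) * b i) * hI

theorem isSimple_periodTorus {T : Matrix (Fin g) (Fin g) ℤ} {y : ℝ} (hy : 0 < y)
    (hytr : Transcendental ℚ (y * Complex.I))
    (hT : ∀ S : Submodule ℚ (Fin g → ℚ), (∀ w ∈ S, T.map (Int.cast : ℤ → ℚ) *ᵥ w ∈ S) →
      S = ⊥ ∨ S = ⊤) : (periodTorus T y hy).IsSimple := by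
  refine isSimple_of_subspaces _ ?_
  rintro m B hB ⟨e, he, hlat⟩
  choose a b hab using fun i => (mem_lattice_periodTorus T hy _).1 (hlat i)
  have hrank : finrank ℂ (LinearMap.range B) = m := by
    rw [LinearMap.finrank_range_of_inj hB, finrank_fin_fun]
  have hs : (y * Complex.I : ℂ) ≠ 0 :=
    mul_ne_zero (by exact_mod_cast hy.ne') Complex.I_ne_zero
  let T' := T.map (Int.cast : ℤ → ℚ)
  let w : Fin (2 * m) → (Fin g → ℚ) × (Fin g → ℚ) := fun i => (fun k => a i k, fun k => b i k)
  have hpencil : ∀ i, pencil (T'.map (Rat.cast : ℚ → ℂ)) (y * Complex.I)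
      (toComplex (w i).1, toComplex (w i).2) = (y * Complex.I : ℂ) • B (e i) := fun i => by
    rw [hab i]
    exact pencil_eq_smul_period T hy (a i) (b i)
  have hw : ∀ i, w i ∈ rationalPart T' (y * Complex.I) (LinearMap.range B) := fun i => by
    rw [mem_rationalPart, hpencil]
    exact Submodule.smul_mem _ _ ⟨e i, rfl⟩
  have hli : LinearIndependent ℚ w := by
    have h1 : LinearIndependent ℝ fun i => (y * Complex.I : ℂ) • B (e i) := by
      let L : (Fin m → ℂ) →ₗ[ℝ] (Fin g → ℂ) := ((y * Complex.I : ℂ) • B).restrictScalars ℝ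
      have hL : LinearMap.ker L = ⊥ := LinearMap.ker_eq_bot_of_injective fun v v' h =>
        hB (smul_right_injective _ hs h)
      exact he.map' L hL
    have h2 : LinearIndependent ℚ fun i => (y * Complex.I : ℂ) • B (e i) :=
      h1.restrict_scalars (smul_left_injective ℚ one_ne_zero)
    simp only [← hpencil] at h2
    exact LinearIndependent.of_comp (((pencil (T'.map (Rat.cast : ℚ → ℂ))
      (y * Complex.I)).restrictScalars ℚ) ∘ₗ toComplex.prodMap toComplex) h2
  have hli' : LinearIndependent ℚ fun i =>
      (⟨w i, hw i⟩ : rationalPart T' (y * Complex.I) (LinearMap.range B)) :=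
    LinearIndependent.of_comp (Submodule.subtype _) hli
  have hdim := hli'.fintype_card_le_finrank
  rw [Fintype.card_fin] at hdim
  have := finrank_eq_zero_or_eq hytr (LinearMap.range B) hT (by rw [hrank]; exact hdim)
  rwa [hrank] at this

theorem exists_pos_transcendental : ∃ y : ℝ, 0 < y ∧ Transcendental ℚ (y * Complex.I : ℂ) := by
  have htr := transcendental_liouvilleNumber (m := 2) le_rfl
  have hne : liouvilleNumber ((2 : ℕ) : ℝ) ≠ 0 := fun h => htr (h ▸ isAlgebraic_zero)
  have hnn : 0 ≤ liouvilleNumber ((2 : ℕ) : ℝ) := tsum_nonneg fun i => by positivity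
  refine ⟨_, lt_of_le_of_ne hnn hne.symm, fun halg => htr ?_⟩
  have hI : IsAlgebraic ℚ Complex.I := by
    refine ⟨Polynomial.X ^ 2 + 1, (Polynomial.monic_X_pow_add_C 1 two_ne_zero).ne_zero, ?_⟩
    simp
  have h1 := (halg.mul hI).neg
  rw [mul_assoc, Complex.I_mul_I, mul_neg_one, neg_neg] at h1
  have h2 := (isAlgebraic_algebraMap_iff (R := ℚ) (algebraMap ℝ ℂ).injective).1 h1
  exact (IsFractionRing.isAlgebraic_iff ℤ ℚ ℝ).2 h2

end ComplexTorus

open ComplexTorus in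
/-- The automorphism `T` of the torus `ℂ^g / (ℤ^g + τ ℤ^g)` has an eigenvalue outside the unit
circle, hence its first dynamical degree exceeds `1`. -/
theorem degreesB_nonempty {g : ℕ} (hg : 2 ≤ g) : (degreesB g).Nonempty := by
  obtain ⟨T, T', G, h1, h2, hG, hGT, hpos, ⟨z, hz, hz1⟩, hT⟩ :=
    Matrix.exists_unimodular_selfAdjoint hg
  obtain ⟨y, hy, hytr⟩ := exists_pos_transcendental
  have hcomm : T' * T = T * T' := h2.trans h1.symm
  let X := periodTorus T y hy
  have hmul : ∀ {A A' : Matrix (Fin g) (Fin g) ℤ}, A * A' = 1 →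
      A.map (Int.cast : ℤ → ℂ) * A'.map (Int.cast : ℤ → ℂ) = 1 := fun {A A'} h => by
    have := (Int.castRingHom ℂ).mapMatrix.map_mul A A'
    rw [h, map_one] at this
    exact this.symm
  let f := X.endoOfMatrix _ (mulVec_mem_lattice_periodTorus hy (rfl : T * T = T * T))
  let f' := X.endoOfMatrix _ (mulVec_mem_lattice_periodTorus hy hcomm)
  have hrep : analyticRep f = T.map (Int.cast : ℤ → ℂ) := analyticRep_eq _ fun v => rfl
  refine ⟨(analyticRep f).specRad ^ 2, ⟨X, isAbelianVariety_periodTorus hy hG hGT hpos,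
    isSimple_periodTorus hy hytr hT, f, ⟨⟨f, f', ?_, ?_⟩, rfl⟩,
    (isFirstDynamicalDegree_iff f _).2 rfl⟩, ?_⟩
  · exact X.endoOfMatrix_mul_eq_one _ _ (hmul h1)
  · exact X.endoOfMatrix_mul_eq_one _ _ (hmul h2)
  · rw [Set.mem_singleton_iff, hrep]
    have := hz1.trans_le (Matrix.norm_le_specRad hz)
    exact (one_lt_pow₀ this two_ne_zero).ne'

theorem degreesB_subset_degreesA (g : ℕ) : degreesB g ⊆ degreesA g := by
  rintro lam ⟨⟨X, hX, -, f, hf, hlam⟩, h1⟩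
  refine ⟨⟨X, hX, f, fun x => ?_, hlam⟩, h1⟩
  obtain ⟨u, rfl⟩ := hf
  refine ⟨(↑u⁻¹ : X.endo).1 x, ?_⟩
  have h : (u : X.endo) * (↑u⁻¹ : X.endo) = 1 := u.mul_inv
  exact DFunLike.congr_fun (congrArg Subtype.val h) x

theorem theoremC (g : ℕ) (hg : 2 ≤ g) :
    (∃ a, IsLeast (degreesA g) a) ∧ (∃ b, IsLeast (degreesB g) b) := by
  refine ⟨ComplexTorus.exists_isLeast_of_firstDynamicalDegree (g := g)
    ((degreesB_nonempty hg).mono (degreesB_subset_degreesA g)) ?_,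
    ComplexTorus.exists_isLeast_of_firstDynamicalDegree (g := g) (degreesB_nonempty hg) ?_⟩
  · rintro lam ⟨⟨X, -, f, -, hlam⟩, -⟩
    exact ⟨X, f, hlam⟩
  · rintro lam ⟨⟨X, -, -, f, -, hlam⟩, -⟩
    exact ⟨X, f, hlam⟩
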